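/- Let $G$ be a finite group, $A\subset G$ an abelian subgroup, $A^*$ its character group (written additively), $H=\mathbb C[G]$ with its standard Hopf algebra structure $(\Delta,\varepsilon)$, and $P_\mu$ ($\mu\in A^*$) the primitive idempotents of $\mathbb C[A]$, with $aP_\mu=\mu(a)P_\mu$ for $a\in A$. For a $G$-module $U$ let $U[\mu]=P_\mu U$ be the subspace of weight $\mu$. A *dynamical twist* is a function $J:A^*\to H\otimes H$ with invertible values commuting with $\Delta(a)$ for all $a\in A$, such that $J^{12,3}(\lambda)\,J^{12}(\lambda-h^{(3)})=J^{1,23}(\lambda)\,J^{23}(\lambda)$ and $(\varepsilon\otimes\mathrm{id})J(\lambda)=(\mathrm{id}\otimes\varepsilon)J(\lambda)=1$, where $J^{12,3}=(\Delta\otimes\mathrm{id})J$, $J^{1,23}=(\mathrm{id}\otimes\Delta)J$, $J^{12}(\lambda-h^{(3)})=\sum_\mu J(\lambda-\mu)\otimes P_\mu$, $J^{23}=1\otimes J$. A *vertex-IRF transformation of $1\otimes1$* is a function $x:A^*\to H^\times$ with $\varepsilon(x(\lambda))=1$ such that $$(1\otimes1)^x(\lambda)=\Delta(x(\lambda))\,\bigl(1\otimes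 x(\lambda)^{-1}\bigr)\sum_{\mu}x(\lambda-\mu)^{-1}\otimes P_\mu$$ commutes with $\Delta(a)$ for all $a\in A$. It is *normalizing* if its values lie in the normalizer $N_A$ of $\mathbb C[A]$ in $H^\times$; let $\pi:N_A\to\mathrm{Perm}(A^*)$ be given by $yP_\mu y^{-1}=P_{\pi(y)(\mu)}$. A normalizing $x$ *realizes* a bijection $f:A^*\to A^*$ if $\pi(x(\lambda))^{-1}(\mu)=f(\lambda)-f(\lambda-\mu)$ for all $\lambda,\mu$. A *dynamical datum* for $(G,A)$ is a subgroup $K\subset G$ with irreducible projective representations $V_\lambda$ ($\lambda\in A^*$) of $K$ such that $V_\lambda\otimes V_\mu^*$ is linear and $\mathrm{Ind}_K^G(V_\lambda\otimes V_\mu^*)\cong\mathrm{Ind}_A^G(\lambda-\mu)$ for all $\lambda,\mu$. A dynamical twist $J$ *corresponds* to it if there are isomorphisms $\Psi_{\lambda,\mu}:U[\lambda-\mu]\to\mathrm{Hom}_K(V_\lambda,V_\mu\otimes U)$, natural in the finite-dimensional $G$-module $U$, such that for $u\in U[\mu-\nu]$, $w\in W[\lambda-\mu]$ the composition $V_\lambda\to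 V_\mu\otimes W\to V_\nu\otimes U\otimes W$ of $\Psi_{\lambda,\mu}(w)$ and $\Psi_{\mu,\nu}(u)\otimes\mathrm{id}$ equals $\Psi_{\lambda,\nu}(J(\lambda)(u\otimes w))$. **Proposition 3.3.** (1) A function $f:A^*\to A^*$ is realized by a normalizing vertex-IRF transformation of $1\otimes1$ if and only if $\mathrm{Ind}_A^G(\lambda-\mu)\cong\mathrm{Ind}_A^G(f(\lambda)-f(\mu))$ for all $\lambda,\mu\in A^*$. (2) Let $J$ be a dynamical twist. Then $J=(1\otimes1)^x$ for some normalizing vertex-IRF transformation $x$ if and only if $J$ corresponds to a dynamical datum with $K=A$. Moreover, if $J$ corresponds to a dynamical datum $(K,\{V_\lambda\})$, then $J$ is of this form if and only if $K$ is conjugate to $A$ in $G$. -/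

import Mathlib

open scoped TensorProduct

noncomputable section

namespace DynTwist

universe u

/-! ### The group algebra, the character group, idempotents

The group `A^*` of characters of the finite abelian group `A` is written multiplicatively, so that
`l - m` is `l / m` and the weight `0` is `1`. -/

/-- The group algebra `H = ℂ[G]`, with Mathlib's Hopf algebra structure. -/
abbrev GrpAlg (G : Type u) : Type u := MonoidAlgebra ℂ G

/-- The group `A^*` of complex characters of `A`. -/
abbrev CharGroup {G : Type u} [Group G] (A : Subgroup G) : Type u := A →* ℂˣ

instance charGroupFintype {G : Type u} [Group G] [Finite G] (A : Subgroup G) :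
    Fintype (CharGroup A) := Fintype.ofFinite _

/-- A group element as an element of `ℂ[G]`. -/
abbrev gpEl {G : Type u} [Group G] (g : G) : GrpAlg G := MonoidAlgebra.of ℂ G g

/-- The primitive idempotent `P_m = |A|⁻¹ ∑ₐ m(a)⁻¹ a` of `ℂ[A]`; it satisfies `a P_m = m(a) P_m`,
and acts in every representation as the projection to the subspace of weight `m`. -/
def idem {G : Type u} [Group G] [Finite G] (A : Subgroup G) (m : CharGroup A) : GrpAlg G :=
  letI := Fintype.ofFinite A
  ((Nat.card A : ℂ)⁻¹) • ∑ a : A, (((m a)⁻¹ : ℂˣ) : ℂ) • gpEl (a : G)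

/-- The subspace `ℂ[A]` of `ℂ[G]`. -/
def subAlg {G : Type u} [Group G] (A : Subgroup G) : Submodule ℂ (GrpAlg G) :=
  Submodule.span ℂ (Set.range fun a : A => gpEl (a : G))

/-- `y` lies in the normalizer `N_A` of `ℂ[A]` in the multiplicative group `ℂ[G]ˣ`. -/
def MemNormalizer {G : Type u} [Group G] (A : Subgroup G) (y : (GrpAlg G)ˣ) : Prop :=
  ∀ c : GrpAlg G, c ∈ subAlg A ↔ (y : GrpAlg G) * c * (↑y⁻¹ : GrpAlg G) ∈ subAlg A

/-! ### Dynamical twists -/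

/-- The coproduct of `ℂ[G]`. -/
abbrev Delta (G : Type u) [Group G] : GrpAlg G →ₐ[ℂ] GrpAlg G ⊗[ℂ] GrpAlg G :=
  Bialgebra.comulAlgHom ℂ (GrpAlg G)

/-- The counit of `ℂ[G]`. -/
abbrev eps (G : Type u) [Group G] : GrpAlg G →ₐ[ℂ] ℂ :=
  Bialgebra.counitAlgHom ℂ (GrpAlg G)

/-- Zero weight for an element of `H ⊗ H`: it commutes with `Δ(a)` for all `a ∈ A`. -/
def ZeroWeight₂ {G : Type u} [Group G] (A : Subgroup G) (F : GrpAlg G ⊗[ℂ] GrpAlg G) : Prop :=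
  ∀ a ∈ A, Delta G (gpEl a) * F = F * Delta G (gpEl a)

/-- A dynamical twist `J : A^* → H ⊗ H`. The equation
`J^{12,3}(l) J^{12}(l - h^{(3)}) = J^{1,23}(l) J^{23}(l)` is written in `H ⊗ (H ⊗ H)`, where
`J^{12}(l - h^{(3)}) = ∑ₘ J(l - m) ⊗ P_m`. -/
structure IsDynamicalTwist {G : Type u} [Group G] [Finite G] (A : Subgroup G)
    (J : CharGroup A → GrpAlg G ⊗[ℂ] GrpAlg G) : Prop where
  zeroWeight : ∀ l, ZeroWeight₂ A (J l)
  isUnit : ∀ l, IsUnit (J l)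
  twist : ∀ l,
    Algebra.TensorProduct.assoc ℂ ℂ ℂ (GrpAlg G) (GrpAlg G) (GrpAlg G)
        (Algebra.TensorProduct.map (Delta G) (AlgHom.id ℂ (GrpAlg G)) (J l) *
          ∑ m : CharGroup A, J (l / m) ⊗ₜ[ℂ] idem A m) =
      Algebra.TensorProduct.map (AlgHom.id ℂ (GrpAlg G)) (Delta G) (J l) *
        ((1 : GrpAlg G) ⊗ₜ[ℂ] J l)
  counit_left : ∀ l, Algebra.TensorProduct.lid ℂ (GrpAlg G)
    (Algebra.TensorProduct.map (eps G) (AlgHom.id ℂ (GrpAlg G)) (J l)) = 1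
  counit_right : ∀ l, Algebra.TensorProduct.rid ℂ ℂ (GrpAlg G)
    (Algebra.TensorProduct.map (AlgHom.id ℂ (GrpAlg G)) (eps G) (J l)) = 1

/-! ### Vertex-IRF transformations -/

/-- The canonical projection `A^* → B^*` for `B ≤ A`. -/
def restrict {G : Type u} [Group G] {A B : Subgroup G} (h : B ≤ A) (l : CharGroup A) :
    CharGroup B := l.comp (Subgroup.inclusion h)

/-- The transform
`J^x(l) = Δ(x(l)) J(l|_B) x²(l)⁻¹ x¹(l - h^{(2)})⁻¹` of `J : B^* → H ⊗ H` by `x : A^* → Hˣ`.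
Since the `P_m` are orthogonal idempotents with sum `1`, the inverse of
`x¹(l - h^{(2)}) = ∑ₘ x(l - m) ⊗ P_m` is `∑ₘ x(l - m)⁻¹ ⊗ P_m`. -/
def transform {G : Type u} [Group G] [Finite G] {A B : Subgroup G} (h : B ≤ A)
    (J : CharGroup B → GrpAlg G ⊗[ℂ] GrpAlg G) (x : CharGroup A → (GrpAlg G)ˣ)
    (l : CharGroup A) : GrpAlg G ⊗[ℂ] GrpAlg G :=
  Delta G (x l : GrpAlg G) * J (restrict h l) *
    ((1 : GrpAlg G) ⊗ₜ[ℂ] (↑(x l)⁻¹ : GrpAlg G)) *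
    ∑ m : CharGroup A, (↑(x (l / m))⁻¹ : GrpAlg G) ⊗ₜ[ℂ] idem A m

/-- `x : A^* → Hˣ` is a vertex-IRF transformation of `J : B^* → H ⊗ H`: it has zero weight with
respect to `B`, `ε(x(l)) = 1`, and `J^x` has zero weight with respect to `A`. -/
structure IsVertexIRF {G : Type u} [Group G] [Finite G] {A B : Subgroup G} (h : B ≤ A)
    (J : CharGroup B → GrpAlg G ⊗[ℂ] GrpAlg G) (x : CharGroup A → (GrpAlg G)ˣ) : Prop where
  zeroWeight : ∀ l, ∀ b ∈ B, gpEl b * (x l : GrpAlg G) = (x l : GrpAlg G) * gpEl b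
  counit : ∀ l, eps G (x l : GrpAlg G) = 1
  transform_zeroWeight : ∀ l, ZeroWeight₂ A (transform h J x l)

/-- The twist `1 ⊗ 1`, for the trivial subgroup. -/
def oneTwist (G : Type u) [Group G] : CharGroup (⊥ : Subgroup G) → GrpAlg G ⊗[ℂ] GrpAlg G :=
  fun _ => 1

/-- `x` is a vertex-IRF transformation of `1 ⊗ 1` with values in the normalizer `N_A`. -/
structure IsNormalizingVertexIRF {G : Type u} [Group G] [Finite G] (A : Subgroup G)
    (x : CharGroup A → (GrpAlg G)ˣ) : Prop where
  isVertexIRF : IsVertexIRF (bot_le : ⊥ ≤ A) (oneTwist G) x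
  normalizes : ∀ l, MemNormalizer A (x l)

/-- `x` realizes `f : A^* → A^*`: `f` is bijective, `x` is a vertex-IRF transformation of `1 ⊗ 1`
with values in `N_A`, and `π(x(l))⁻¹(m) = f(l) - f(l - m)`, where `N_A` acts on the primitive
idempotents of `ℂ[A]` by `y P_m y⁻¹ = P_{π(y)(m)}`. -/
structure Realizes {G : Type u} [Group G] [Finite G] (A : Subgroup G)
    (x : CharGroup A → (GrpAlg G)ˣ) (f : CharGroup A → CharGroup A) : Prop where
  isNormalizingVertexIRF : IsNormalizingVertexIRF A x
  bijective : Function.Bijective f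
  perm : ∀ l m, (↑(x l)⁻¹ : GrpAlg G) * idem A m * (x l : GrpAlg G) = idem A (f l / f (l / m))

/-- `J` is obtained from `1 ⊗ 1` by a vertex-IRF transformation with values in `N_A`. -/
def ObtainedFromOne {G : Type u} [Group G] [Finite G] (A : Subgroup G)
    (J : CharGroup A → GrpAlg G ⊗[ℂ] GrpAlg G) : Prop :=
  ∃ x : CharGroup A → (GrpAlg G)ˣ, IsNormalizingVertexIRF A x ∧
    ∀ l, J l = transform (bot_le : ⊥ ≤ A) (oneTwist G) x l

/-! ### Dynamical data -/

/-- The one-dimensional representation of `A` with character `m`. -/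
def charRep {G : Type u} [Group G] {A : Subgroup G} (m : CharGroup A) : Representation ℂ A ℂ where
  toFun a := ((m a : ℂˣ) : ℂ) • (1 : Module.End ℂ ℂ)
  map_one' := by simp
  map_mul' a b := by ext; simp [mul_comm]

/-- The representation `Ind_A^G(m)`. -/
abbrev indChar {G : Type u} [Group G] (A : Subgroup G) (m : CharGroup A) :=
  Representation.ind A.subtype (charRep m)

/-- A dynamical datum for `(G, A)`: a subgroup `K` of `G` and irreducible projective
representations `V_l` of `K`, for `l ∈ A^*`, such that `V_l ⊗ V_m^*` is a linear representation and
`Ind_K^G(V_l ⊗ V_m^*) ≅ Ind_A^G(l - m)`. A projective representation is given by operators `ρ(g)`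
with `ρ(g h)` a multiple of `ρ(g) ρ(h)`. -/
structure DynamicalDatum {G : Type u} [Group G] (A : Subgroup G) where
  K : Subgroup G
  V : CharGroup A → Type
  [addCommGroup : ∀ l, AddCommGroup (V l)]
  [module : ∀ l, Module ℂ (V l)]
  [finiteDimensional : ∀ l, FiniteDimensional ℂ (V l)]
  ρ : ∀ l, K → (V l ≃ₗ[ℂ] V l)
  projective : ∀ l (g h : K), ∃ c : ℂˣ, ∀ v : V l, ρ l (g * h) v = (c : ℂ) • ρ l g (ρ l h v)
  nontrivial : ∀ l, Nontrivial (V l)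
  irreducible : ∀ l (W : Submodule ℂ (V l)),
    (∀ (g : K), ∀ w ∈ W, ρ l g w ∈ W) → W = ⊥ ∨ W = ⊤
  /-- The linear representation `V_l ⊗ V_m^*`; by the next field `K` acts in it by
  `ρ_l(g) ⊗ (ρ_m(g)⁻¹)^*`. -/
  lin : ∀ l m, Representation ℂ K (V l ⊗[ℂ] Module.Dual ℂ (V m))
  lin_apply : ∀ l m (g : K), lin l m g =
    TensorProduct.map (ρ l g).toLinearMap (ρ m g).symm.toLinearMap.dualMap
  ind_equiv : ∀ l m, Nonempty
    ((Representation.ind K.subtype (lin l m)).Equiv (indChar A (l / m)))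

attribute [instance] DynamicalDatum.addCommGroup DynamicalDatum.module
  DynamicalDatum.finiteDimensional

/-! ### The exchange construction -/

/-- The subspace `U[m]` of vectors of weight `m` in a representation of `G`. -/
def weightSpace {G : Type u} [Group G] (A : Subgroup G) {U : Type u} [AddCommGroup U] [Module ℂ U]
    (τ : Representation ℂ G U) (m : CharGroup A) : Submodule ℂ U where
  carrier := {v | ∀ a : A, τ (a : G) v = ((m a : ℂˣ) : ℂ) • v}
  zero_mem' := by simp
  add_mem' := by
    intro v w hv hw a
    rw [map_add, hv a, hw a, smul_add]
  smul_mem' := by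
    intro c v hv a
    rw [map_smul, hv a, smul_comm]

/-- The action of `H ⊗ H` on the tensor product of two representations. -/
def act₂ {G : Type u} [Group G] {U W : Type u} [AddCommGroup U] [Module ℂ U]
    [AddCommGroup W] [Module ℂ W] (τ : Representation ℂ G U) (σ : Representation ℂ G W) :
    GrpAlg G ⊗[ℂ] GrpAlg G →ₐ[ℂ] Module.End ℂ (U ⊗[ℂ] W) :=
  (Module.endTensorEndAlgHom (R := ℂ) (S := ℂ) (A := ℂ) (M := U) (N := W)).comp
    (Algebra.TensorProduct.map τ.asAlgebraHom σ.asAlgebraHom)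

/-- `Hom_K(V_l, V_m ⊗ U)`. -/
def DynamicalDatum.homK {G : Type u} [Group G] {A : Subgroup G} (D : DynamicalDatum A)
    {U : Type u} [AddCommGroup U] [Module ℂ U] (τ : Representation ℂ G U) (l m : CharGroup A) :
    Submodule ℂ (D.V l →ₗ[ℂ] D.V m ⊗[ℂ] U) where
  carrier := {φ | ∀ (k : D.K) (v : D.V l),
    φ (D.ρ l k v) = TensorProduct.map (D.ρ m k).toLinearMap (τ (k : G)) (φ v)}
  zero_mem' := by simp
  add_mem' := by
    intro φ ψ hφ hψ k v
    rw [LinearMap.add_apply, LinearMap.add_apply, hφ k v, hψ k v, map_add]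
  smul_mem' := by
    intro c φ hφ k v
    rw [LinearMap.smul_apply, LinearMap.smul_apply, hφ k v, map_smul]

/-- A system of isomorphisms `Ψ(l, ·) : U[l - m] ≅ Hom_K(V_l, V_m ⊗ U)`, natural in the
finite-dimensional `G`-module `U`. -/
structure ExchangeSystem {G : Type u} [Group G] {A : Subgroup G} (D : DynamicalDatum A) where
  Ψ : ∀ {U : Type u} [AddCommGroup U] [Module ℂ U] [FiniteDimensional ℂ U]
    (τ : Representation ℂ G U) (l m : CharGroup A),
    weightSpace A τ (l / m) ≃ₗ[ℂ] D.homK τ l m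
  natural : ∀ {U U' : Type u} [AddCommGroup U] [Module ℂ U] [FiniteDimensional ℂ U]
    [AddCommGroup U'] [Module ℂ U'] [FiniteDimensional ℂ U']
    (τ : Representation ℂ G U) (τ' : Representation ℂ G U') (φ : τ.IntertwiningMap τ')
    (l m : CharGroup A) (v : weightSpace A τ (l / m)) (v' : weightSpace A τ' (l / m)),
    (v' : U') = φ (v : U) →
      (Ψ τ' l m v' : D.V l →ₗ[ℂ] D.V m ⊗[ℂ] U') =
        (φ.toLinearMap.lTensor (D.V m)) ∘ₗ (Ψ τ l m v : D.V l →ₗ[ℂ] D.V m ⊗[ℂ] U)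

/-- The dynamical twist `J` corresponds to the dynamical datum `D` under the exchange construction:
for a system `Ψ` as above, the composition `V_l → V_m ⊗ W → V_n ⊗ U ⊗ W` of `Ψ(l, w)` and
`Ψ(m, v) ⊗ id`, where `w ∈ W[l - m]` and `v ∈ U[m - n]`, is `Ψ(l, J(l)(v ⊗ w))`.
Changing `Ψ` changes `J` by a gauge transformation. -/
def Corresponds {G : Type u} [Group G] {A : Subgroup G}
    (J : CharGroup A → GrpAlg G ⊗[ℂ] GrpAlg G) (D : DynamicalDatum A) : Prop :=
  ∃ E : ExchangeSystem D,
    ∀ (U W : Type u) [AddCommGroup U] [Module ℂ U] [FiniteDimensional ℂ U]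
      [AddCommGroup W] [Module ℂ W] [FiniteDimensional ℂ W]
      (τ : Representation ℂ G U) (σ : Representation ℂ G W) (l m n : CharGroup A)
      (v : weightSpace A τ (m / n)) (w : weightSpace A σ (l / m)),
      ∃ z : weightSpace A (τ.tprod σ) (l / n),
        (z : U ⊗[ℂ] W) = act₂ τ σ (J l) ((v : U) ⊗ₜ[ℂ] (w : W)) ∧
        (E.Ψ (τ.tprod σ) l n z : D.V l →ₗ[ℂ] D.V n ⊗[ℂ] (U ⊗[ℂ] W)) =
          (TensorProduct.assoc ℂ (D.V n) U W).toLinearMap ∘ₗ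
            ((E.Ψ τ m n v : D.V m →ₗ[ℂ] D.V n ⊗[ℂ] U).rTensor W) ∘ₗ
              (E.Ψ σ l m w : D.V l →ₗ[ℂ] D.V m ⊗[ℂ] W)

end DynTwist

end

open scoped TensorProduct

noncomputable section

namespace DynTwist

universe u

variable {G : Type u} [Group G]

/-! ### The primitive idempotents of `ℂ[A]` -/

section GroupElements

/-! Everything is controlled by the primitive idempotents P_m = `idem A m`. Conjugation by an
element of the normalizer permutes them (`MemNormalizer.exists_idem`). For x normalizing, the zero
weight condition on the transform of 1 ⊗ 1 says that these permutations σ_l satisfy a cocycle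
equation (`transform_zeroWeight_iff`), and every solution is a coboundary f(l) / f(l / m). On the
other side, Ind_A^G(m) is the left ideal ℂ[G] P_m, so an isomorphism Ind_A^G(m) ≅ Ind_A^G(k) is a
pair u, v with u v = P_m and v u = P_k (`nonempty_indChar_equiv_iff`). A unit that conjugates one
idempotent to the other gives such a pair. Conversely, pairs chosen for all m, with targets running
through a permutation, add up to a unit. This is `exists_realizes_iff`, the first claim.

Let now J be the transform of 1 ⊗ 1 by x, where x realizes f. Taking V_l to be the line on which A
acts by f(l), the maps u ↦ x(l)⁻¹ u are exchange isomorphisms whose composition law is J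
(`Realizes.corresponds`); this is a dynamical datum with K = A.

For an arbitrary datum (K, V) corresponding to the same J, the maps u ↦ Ψ(x(l) u) on A-fixed vectors
are multiplicative. Applied to the functions on G/A, they turn the delta function at the base point
into a K-equivariant family of idempotents of V_l indexed by G/A with idempotent sum. At most d =
dim V_l of them are nonzero, so K has an orbit on G/A of size at most d. Comparing dimensions of
induced modules gives |K| = d² |A|, while stabilizers in K have order at most |A|; hence d = 1 and K
is conjugate to A (`Realizes.conj_of_corresponds`).

Conversely, if K = g A g⁻¹, the same count makes all V_l lines. By naturality each Ψ is the action
of an element of ℂ[G]; multiplied by g⁻¹ and summed over m, these elements form x(l)⁻¹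
(`obtainedFromOne_of_corresponds`). -/

lemma sum_char_eq_ite (A : Subgroup G) [Fintype A] (m : CharGroup A) [Decidable (m = 1)] :
    ∑ a : A, ((m a : ℂˣ) : ℂ) = if m = 1 then (Nat.card A : ℂ) else 0 := by
  classical
  have h := sum_hom_units ((Units.coeHom ℂ).comp m)
  have h1 : (Units.coeHom ℂ).comp m = 1 ↔ m = 1 := by
    constructor
    · intro h
      ext a
      simpa using DFunLike.congr_fun h a
    · rintro rfl
      ext a
      simp
  simp only [h1, MonoidHom.comp_apply, Units.coeHom_apply] at h
  rw [h, Nat.card_eq_fintype_card]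
  split_ifs <;> simp

lemma leftRegular_asAlgebraHom_apply (x y : GrpAlg G) :
    (Representation.leftRegular ℂ G).asAlgebraHom x y = x * y :=
  Representation.asAlgebraHom_ofMulAction_smul_eq_mul x y

lemma leftRegular_apply (g : G) (y : GrpAlg G) :
    Representation.leftRegular ℂ G g y = gpEl g * y := by
  rw [← leftRegular_asAlgebraHom_apply, Representation.asAlgebraHom_of]

/-- The coefficient of the identity element. -/
def coeffOne (G : Type u) [Group G] : GrpAlg G →ₗ[ℂ] ℂ :=
  (Finsupp.lapply 1) ∘ₗ (MonoidAlgebra.coeffLinearEquiv ℂ).toLinearMap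

lemma coeffOne_gpEl [DecidableEq G] (g : G) : coeffOne G (gpEl g) = if g = 1 then 1 else 0 := by
  simp [coeffOne, MonoidAlgebra.of_apply, Finsupp.single_apply]

lemma eps_gpEl (g : G) : eps G (gpEl g) = 1 := by simp

lemma Delta_gpEl (g : G) : Delta G (gpEl g) = gpEl g ⊗ₜ gpEl g := by simp

lemma gpEl_mem_subAlg {A : Subgroup G} (a : A) : gpEl (a : G) ∈ subAlg A :=
  Submodule.subset_span ⟨a, rfl⟩

end GroupElements

section Idempotents

variable [Finite G] (A : Subgroup G)

/-- Characters separate points: some k has k(a) ≠ 1, and translating the sum by k multiplies it by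
k(a). -/
lemma sum_char_apply_eq_zero [IsMulCommutative A] {a : A} (ha : a ≠ 1) :
    ∑ m : CharGroup A, ((m a : ℂˣ) : ℂ) = 0 := by
  classical
  let _ : CommGroup A := { (inferInstance : Group A) with mul_comm := mul_comm' }
  obtain ⟨k, hk⟩ := CommGroup.exists_apply_ne_one_of_hasEnoughRootsOfUnity A ℂ ha
  have hk' : ((k a : ℂˣ) : ℂ) ≠ 1 := by simpa using hk
  have h : ((k a : ℂˣ) : ℂ) * ∑ m : CharGroup A, ((m a : ℂˣ) : ℂ) =
      ∑ m : CharGroup A, ((m a : ℂˣ) : ℂ) := by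
    rw [Finset.mul_sum]
    refine Fintype.sum_equiv (Equiv.mulLeft k) _ _ fun m => ?_
    simp
  by_contra h0
  exact hk' (mul_right_cancel₀ h0 (by rw [h, one_mul]))

lemma card_charGroup [IsMulCommutative A] : Fintype.card (CharGroup A) = Nat.card A := by
  let _ : CommGroup A := { (inferInstance : Group A) with mul_comm := mul_comm' }
  rw [← Nat.card_eq_fintype_card]
  exact CommGroup.card_monoidHom_of_hasEnoughRootsOfUnity A ℂ

variable {A}

lemma card_ne_zero' : (Nat.card A : ℂ) ≠ 0 :=
  Nat.cast_ne_zero.2 Nat.card_pos.ne'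

lemma gpEl_mul_idem (a : A) (m : CharGroup A) :
    gpEl (a : G) * idem A m = ((m a : ℂˣ) : ℂ) • idem A m := by
  let _ := Fintype.ofFinite A
  unfold idem
  rw [mul_smul_comm, smul_comm ((m a : ℂˣ) : ℂ), Finset.mul_sum]
  congr 1
  rw [Finset.smul_sum]
  refine Fintype.sum_equiv (Equiv.mulLeft a) _ _ fun b => ?_
  simp only [Equiv.coe_mulLeft, mul_smul_comm, smul_smul, Subgroup.coe_mul, map_mul,
    mul_inv_rev, Units.val_mul]
  congr 1
  simp [mul_comm]

lemma idem_mul_gpEl [IsMulCommutative A] (a : A) (m : CharGroup A) :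
    idem A m * gpEl (a : G) = ((m a : ℂˣ) : ℂ) • idem A m := by
  rw [← gpEl_mul_idem]
  unfold idem
  rw [smul_mul_assoc, mul_smul_comm, Finset.mul_sum, Finset.sum_mul]
  congr 1
  refine Finset.sum_congr rfl fun b _ => ?_
  rw [smul_mul_assoc, mul_smul_comm, ← map_mul, ← map_mul, ← Subgroup.coe_mul,
    ← Subgroup.coe_mul, mul_comm']

/-- Orthogonality of characters: on a vector of weight k the averaging sum collapses to the mean of
k / m over A. -/
lemma idem_mul_eq_smul {M : Type*} [AddCommGroup M] [Module ℂ M] (τ : Representation ℂ G M)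
    (k m : CharGroup A) {v : M} (hv : ∀ a : A, τ (a : G) v = ((k a : ℂˣ) : ℂ) • v)
    [Decidable (k = m)] :
    τ.asAlgebraHom (idem A m) v = if k = m then v else 0 := by
  classical
  let _ := Fintype.ofFinite A
  unfold idem
  simp only [map_smul, map_sum, LinearMap.smul_apply, LinearMap.sum_apply,
    Representation.asAlgebraHom_of, hv, smul_smul, ← Finset.sum_smul]
  have h2 : ∑ a : A, (((m a)⁻¹ : ℂˣ) : ℂ) * ((k a : ℂˣ) : ℂ) =
      if k = m then (Nat.card A : ℂ) else 0 := by
    have h := sum_char_eq_ite A (k / m)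
    have h1 : k / m = 1 ↔ k = m := div_eq_one (G := CharGroup A)
    simp only [MonoidHom.div_apply, Units.val_div_eq_div_val, h1] at h
    rw [← h]
    refine Finset.sum_congr rfl fun a _ => ?_
    rw [Units.val_inv_eq_inv_val]
    ring
  rw [h2]
  split_ifs
  · rw [inv_mul_cancel₀ card_ne_zero', one_smul]
  · simp

lemma idem_mul_of_weight (k m : CharGroup A) {y : GrpAlg G}
    (hy : ∀ a : A, gpEl (a : G) * y = ((k a : ℂˣ) : ℂ) • y) [Decidable (k = m)] :
    idem A m * y = if k = m then y else 0 := by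
  rw [← leftRegular_asAlgebraHom_apply]
  exact idem_mul_eq_smul _ k m fun a => by rw [leftRegular_apply, hy]

lemma idem_mul_idem (m k : CharGroup A) [Decidable (k = m)] :
    idem A m * idem A k = if k = m then idem A k else 0 :=
  idem_mul_of_weight k m fun a => gpEl_mul_idem a k

@[simp]
lemma idem_mul_self (m : CharGroup A) : idem A m * idem A m = idem A m := by
  classical
  rw [idem_mul_idem, if_pos rfl]

lemma idem_mul_idem_of_ne {m k : CharGroup A} (h : m ≠ k) : idem A m * idem A k = 0 := by
  classical
  rw [idem_mul_idem, if_neg h.symm]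

variable (A) in
lemma sum_idem [IsMulCommutative A] : ∑ m : CharGroup A, idem A m = 1 := by
  classical
  let _ := Fintype.ofFinite A
  unfold idem
  rw [← Finset.smul_sum, Finset.sum_comm]
  simp only [← Finset.sum_smul]
  rw [Finset.sum_eq_single (1 : A)]
  · have h : (Fintype.card (CharGroup A) : ℂ) = Nat.card A := by rw [card_charGroup]
    simp [-Nat.card_eq_fintype_card, h, inv_mul_cancel₀ (card_ne_zero' (A := A)),
      MonoidAlgebra.one_def]
  · intro a _ ha
    have := sum_char_apply_eq_zero A (a := a⁻¹) (by simpa using ha)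
    simp only [map_inv] at this
    rw [this, zero_smul]
  · simp

/-- A coefficient that does not vanish shows that the idempotents, and their tensor products, are
nonzero. -/
lemma coeffOne_idem (m : CharGroup A) : coeffOne G (idem A m) = (Nat.card A : ℂ)⁻¹ := by
  classical
  let _ := Fintype.ofFinite A
  unfold idem
  simp only [map_smul, map_sum, coeffOne_gpEl]
  rw [Finset.sum_eq_single (1 : A)]
  · simp
  · intro a _ ha
    simp [ha]
  · simp

lemma idem_ne_zero (m : CharGroup A) : idem A m ≠ 0 := by
  intro h
  have := coeffOne_idem m
  rw [h, map_zero] at this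
  exact inv_ne_zero card_ne_zero' this.symm

lemma idem_tmul_idem_ne_zero (m k : CharGroup A) : idem A m ⊗ₜ[ℂ] idem A k ≠ 0 := by
  intro h
  have := congrArg (LinearMap.mul' ℂ ℂ ∘ₗ TensorProduct.map (coeffOne G) (coeffOne G)) h
  simp only [LinearMap.comp_apply, TensorProduct.map_tmul, LinearMap.mul'_apply, map_zero,
    coeffOne_idem] at this
  exact mul_ne_zero (inv_ne_zero card_ne_zero') (inv_ne_zero card_ne_zero') this

lemma idem_injective : Function.Injective (idem A) := by
  intro m k h
  by_contra hne
  have := idem_mul_idem_of_ne hne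
  rw [← h, idem_mul_self] at this
  exact idem_ne_zero m this

lemma eps_idem (m : CharGroup A) [Decidable (m = 1)] :
    eps G (idem A m) = if m = 1 then 1 else 0 := by
  classical
  let _ := Fintype.ofFinite A
  unfold idem
  simp only [map_smul, map_sum, eps_gpEl, smul_eq_mul, mul_one]
  have h := sum_char_eq_ite A m⁻¹
  have h1 : m⁻¹ = 1 ↔ m = 1 := inv_eq_one (α := CharGroup A)
  simp only [MonoidHom.inv_apply, h1] at h
  rw [h]
  split_ifs
  · exact inv_mul_cancel₀ card_ne_zero'
  · simp

lemma gpEl_eq_sum [IsMulCommutative A] (a : A) :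
    gpEl (a : G) = ∑ m : CharGroup A, ((m a : ℂˣ) : ℂ) • idem A m := by
  conv_lhs => rw [← mul_one (gpEl (a : G)), ← sum_idem A, Finset.mul_sum]
  exact Finset.sum_congr rfl fun m _ => gpEl_mul_idem a m

lemma idem_mem_subAlg (m : CharGroup A) : idem A m ∈ subAlg A :=
  Submodule.smul_mem _ _ (Submodule.sum_mem _ fun a _ =>
    Submodule.smul_mem _ _ (gpEl_mem_subAlg a))

lemma subAlg_eq_span_idem [IsMulCommutative A] :
    subAlg A = Submodule.span ℂ (Set.range (idem A)) := by
  apply le_antisymm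
  · rw [subAlg, Submodule.span_le]
    rintro _ ⟨a, rfl⟩
    simp only [gpEl_eq_sum]
    exact Submodule.sum_mem _ fun m _ => Submodule.smul_mem _ _ (Submodule.subset_span ⟨m, rfl⟩)
  · rw [Submodule.span_le]
    rintro _ ⟨m, rfl⟩
    exact idem_mem_subAlg m

/-- The idempotents `P_m` are primitive in `ℂ[A]`. -/
lemma mul_idem_of_mem_subAlg [IsMulCommutative A] {c : GrpAlg G} (hc : c ∈ subAlg A)
    (m : CharGroup A) :
    ∃ t : ℂ, c * idem A m = t • idem A m := by
  induction hc using Submodule.span_induction with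
  | mem x hx =>
    obtain ⟨a, rfl⟩ := hx
    exact ⟨_, gpEl_mul_idem a m⟩
  | zero => exact ⟨0, by simp⟩
  | add x y _ _ hx hy =>
    obtain ⟨s, hs⟩ := hx
    obtain ⟨t, ht⟩ := hy
    exact ⟨s + t, by rw [add_mul, hs, ht, add_smul]⟩
  | smul r x _ hx =>
    obtain ⟨s, hs⟩ := hx
    exact ⟨r * s, by rw [smul_mul_assoc, hs, smul_smul]⟩

lemma idem_mul_of_mem_subAlg [IsMulCommutative A] {c : GrpAlg G} (hc : c ∈ subAlg A)
    (m : CharGroup A) :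
    ∃ t : ℂ, idem A m * c = t • idem A m := by
  induction hc using Submodule.span_induction with
  | mem x hx =>
    obtain ⟨a, rfl⟩ := hx
    exact ⟨_, idem_mul_gpEl a m⟩
  | zero => exact ⟨0, by simp⟩
  | add x y _ _ hx hy =>
    obtain ⟨s, hs⟩ := hx
    obtain ⟨t, ht⟩ := hy
    exact ⟨s + t, by rw [mul_add, hs, ht, add_smul]⟩
  | smul r x _ hx =>
    obtain ⟨s, hs⟩ := hx
    exact ⟨r * s, by rw [mul_smul_comm, hs, smul_smul]⟩

/-- Under left multiplication by Δ(a), the tensor P_p ⊗ P_q has weight p * q, so the general formula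
for idempotents acting on weight vectors applies. -/
lemma Delta_idem_mul [IsMulCommutative A] (s p q : CharGroup A) [Decidable (p * q = s)] :
    Delta G (idem A s) * (idem A p ⊗ₜ[ℂ] idem A q) =
      if p * q = s then idem A p ⊗ₜ[ℂ] idem A q else 0 := by
  set ρ : Representation ℂ G (GrpAlg G ⊗[ℂ] GrpAlg G) :=
    (((Algebra.lmul ℂ (GrpAlg G ⊗[ℂ] GrpAlg G)).comp
    (Delta G)).toMonoidHom.comp (MonoidAlgebra.of ℂ G)) with hρ
  have h := idem_mul_eq_smul ρ (p * q) s
    (v := idem A p ⊗ₜ[ℂ] idem A q) (fun a => by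
      change Delta G (gpEl (a : G)) * _ = _
      rw [Delta_gpEl, Algebra.TensorProduct.tmul_mul_tmul, gpEl_mul_idem, gpEl_mul_idem,
        TensorProduct.smul_tmul_smul]
      simp)
  rw [← h]
  have h1 : ρ.asAlgebraHom = (Algebra.lmul ℂ (GrpAlg G ⊗[ℂ] GrpAlg G)).comp (Delta G) :=
    MonoidAlgebra.algHom_ext (fun g => by
      rw [Representation.asAlgebraHom_single_one]
      rfl) (Subsingleton.elim _ _)
  rw [h1]
  rfl

/-- Zero weight can be tested on the primitive idempotents. -/
lemma zeroWeight₂_iff [IsMulCommutative A] (F : GrpAlg G ⊗[ℂ] GrpAlg G) :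
    ZeroWeight₂ A F ↔ ∀ s : CharGroup A, Delta G (idem A s) * F = F * Delta G (idem A s) := by
  constructor
  · intro h s
    unfold idem
    simp only [map_smul, map_sum, mul_smul_comm, smul_mul_assoc, Finset.mul_sum, Finset.sum_mul]
    congr 1
    exact Finset.sum_congr rfl fun a _ => by rw [h a a.2]
  · intro h a ha
    have := gpEl_eq_sum (⟨a, ha⟩ : A)
    simp only at this
    rw [this]
    simp only [map_smul, map_sum, mul_smul_comm, smul_mul_assoc, Finset.mul_sum, Finset.sum_mul,
      h]

lemma mem_weightSpace_iff [IsMulCommutative A] {U : Type u} [AddCommGroup U] [Module ℂ U]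
    (τ : Representation ℂ G U) (m : CharGroup A) (v : U) :
    v ∈ weightSpace A τ m ↔ τ.asAlgebraHom (idem A m) v = v := by
  classical
  constructor
  · intro h
    rw [idem_mul_eq_smul τ m m h, if_pos rfl]
  · intro h a
    rw [← h, ← Representation.asAlgebraHom_of, ← Module.End.mul_apply, ← map_mul, gpEl_mul_idem,
      map_smul, LinearMap.smul_apply]

lemma asAlgebraHom_idem_of_mem [IsMulCommutative A] {U : Type u} [AddCommGroup U] [Module ℂ U]
    (τ : Representation ℂ G U) {m : CharGroup A} {v : U} (hv : v ∈ weightSpace A τ m)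
    (k : CharGroup A) [Decidable (m = k)] :
    τ.asAlgebraHom (idem A k) v = if m = k then v else 0 :=
  idem_mul_eq_smul τ m k hv

end Idempotents

/-! ### The normalizer of `ℂ[A]` -/

section Normalizer

variable [Finite G] {A : Subgroup G} [IsMulCommutative A]

/-- The conjugate e of P_m is a nonzero idempotent of ℂ[A], so e P_k ≠ 0 for some k. This product is
a multiple of P_k because P_k is primitive, and a multiple of e because P_m is primitive. Hence e is
proportional to P_k, and idempotence forces the factor to be 1. -/
lemma MemNormalizer.exists_idem {y : (GrpAlg G)ˣ} (hy : MemNormalizer A y) (m : CharGroup A) :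
    ∃ k : CharGroup A, (↑y⁻¹ : GrpAlg G) * idem A m * (y : GrpAlg G) = idem A k := by
  set e : GrpAlg G := (↑y⁻¹ : GrpAlg G) * idem A m * (y : GrpAlg G) with he
  have hye : (y : GrpAlg G) * e * (↑y⁻¹ : GrpAlg G) = idem A m := by
    simp [he, mul_assoc]
  have heA : e ∈ subAlg A := by
    rw [hy, hye]
    exact idem_mem_subAlg m
  have hee : e * e = e := by
    have : e * e = (↑y⁻¹ : GrpAlg G) * (idem A m * idem A m) * (y : GrpAlg G) := by
      simp only [he, mul_assoc, Units.mul_inv_cancel_left]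
    rw [this, idem_mul_self]
  have he0 : e ≠ 0 := by
    intro h
    rw [h] at hye
    exact idem_ne_zero m (by rw [← hye]; simp)
  obtain ⟨k, hk⟩ : ∃ k : CharGroup A, e * idem A k ≠ 0 := by
    by_contra! h
    apply he0
    rw [← mul_one e, ← sum_idem A, Finset.mul_sum]
    exact Finset.sum_eq_zero fun k _ => h k
  refine ⟨k, ?_⟩
  obtain ⟨s, hs⟩ := mul_idem_of_mem_subAlg heA k
  obtain ⟨t, ht⟩ := idem_mul_of_mem_subAlg ((hy (idem A k)).1 (idem_mem_subAlg k)) m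
  have ht' : e * idem A k = t • e := by
    have : e * idem A k = (↑y⁻¹ : GrpAlg G) *
        (idem A m * ((y : GrpAlg G) * idem A k * (↑y⁻¹ : GrpAlg G))) * (y : GrpAlg G) := by
      simp [he, mul_assoc]
    rw [this, ht]
    simp [he]
  have ht0 : t ≠ 0 := by
    rintro rfl
    exact hk (by rw [ht', zero_smul])
  have h1 : e = (t⁻¹ * s) • idem A k := by
    rw [mul_smul, ← hs, ht', smul_smul, inv_mul_cancel₀ ht0, one_smul]
  have h2 : e * idem A k = e := by
    rw [h1, smul_mul_assoc, idem_mul_self]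
  have h3 : s • idem A k = e := by rw [← hs, h2]
  have hs0 : s ≠ 0 := by
    rintro rfl
    exact he0 (by rw [← h3, zero_smul])
  have h4 : (s * s) • idem A k = s • idem A k := by
    conv_rhs => rw [h3, ← hee, ← h3]
    rw [smul_mul_smul_comm, idem_mul_self]
  have h5 : s * s = s := smul_left_injective ℂ (idem_ne_zero k) h4
  have h6 : s = 1 := mul_left_cancel₀ hs0 (by rw [h5, mul_one])
  rw [← h3, h6, one_smul]

lemma memNormalizer_of_perm {y : (GrpAlg G)ˣ} {σ : CharGroup A → CharGroup A}
    (hσ : Function.Bijective σ)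
    (h : ∀ m, (↑y⁻¹ : GrpAlg G) * idem A m * (y : GrpAlg G) = idem A (σ m)) :
    MemNormalizer A y := by
  have h' : ∀ m, (y : GrpAlg G) * idem A (σ m) * (↑y⁻¹ : GrpAlg G) = idem A m := by
    intro m
    rw [← h]
    simp [mul_assoc]
  have hfwd : ∀ c ∈ subAlg A, (y : GrpAlg G) * c * (↑y⁻¹ : GrpAlg G) ∈ subAlg A := by
    intro c hc
    rw [subAlg_eq_span_idem] at hc
    induction hc using Submodule.span_induction with
    | mem x hx =>
      obtain ⟨k, rfl⟩ := hx
      obtain ⟨m, rfl⟩ := hσ.2 k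
      rw [h']
      exact idem_mem_subAlg m
    | zero => simp
    | add x z _ _ hx hz => rw [mul_add, add_mul]; exact Submodule.add_mem _ hx hz
    | smul r x _ hx =>
      rw [mul_smul_comm, smul_mul_assoc]; exact Submodule.smul_mem _ _ hx
  have hbwd : ∀ c ∈ subAlg A, (↑y⁻¹ : GrpAlg G) * c * (y : GrpAlg G) ∈ subAlg A := by
    intro c hc
    rw [subAlg_eq_span_idem] at hc
    induction hc using Submodule.span_induction with
    | mem x hx =>
      obtain ⟨k, rfl⟩ := hx
      rw [h]
      exact idem_mem_subAlg _
    | zero => simp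
    | add x z _ _ hx hz => rw [mul_add, add_mul]; exact Submodule.add_mem _ hx hz
    | smul r x _ hx =>
      rw [mul_smul_comm, smul_mul_assoc]; exact Submodule.smul_mem _ _ hx
  intro c
  refine ⟨hfwd c, fun hc => ?_⟩
  have := hbwd _ hc
  simpa [mul_assoc] using this

end Normalizer

@[simp]
lemma gpEl_one : gpEl (1 : G) = 1 := rfl

lemma gpEl_mul (g h : G) : gpEl (g * h) = gpEl g * gpEl h := map_mul _ _ _

/-! ### Transforms of `1 ⊗ 1` by normalizing functions -/

section Transform

variable [Finite G] {A : Subgroup G}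

/-- The factor P_q in the second leg selects the summand m = q of x¹(l - h^{(2)})⁻¹. -/
lemma transform_oneTwist_mul (x : CharGroup A → (GrpAlg G)ˣ) (l r q : CharGroup A) :
    transform (bot_le : ⊥ ≤ A) (oneTwist G) x l * (idem A r ⊗ₜ[ℂ] idem A q) =
      Delta G (x l : GrpAlg G) * (((↑(x (l / q))⁻¹ : GrpAlg G) * idem A r) ⊗ₜ[ℂ]
        ((↑(x l)⁻¹ : GrpAlg G) * idem A q)) := by
  classical
  unfold transform oneTwist
  rw [mul_one, mul_assoc, mul_assoc, Finset.sum_mul, Finset.sum_eq_single q]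
  · simp [Algebra.TensorProduct.tmul_mul_tmul]
  · intro m _ hm
    simp [Algebra.TensorProduct.tmul_mul_tmul, idem_mul_idem_of_ne hm]
  · simp

lemma inv_mul_idem {y : (GrpAlg G)ˣ} {m k : CharGroup A}
    (h : (↑y⁻¹ : GrpAlg G) * idem A m * (y : GrpAlg G) = idem A k) :
    (↑y⁻¹ : GrpAlg G) * idem A m = idem A k * (↑y⁻¹ : GrpAlg G) := by
  rw [← h, Units.mul_inv_cancel_right]

lemma mul_idem_of_conj {y : (GrpAlg G)ˣ} {m k : CharGroup A}
    (h : (↑y⁻¹ : GrpAlg G) * idem A m * (y : GrpAlg G) = idem A k) :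
    idem A m * (y : GrpAlg G) = (y : GrpAlg G) * idem A k := by
  rw [← h, mul_assoc, Units.mul_inv_cancel_left]

lemma injective_of_conj {y : (GrpAlg G)ˣ} {σ : CharGroup A → CharGroup A}
    (h : ∀ m, (↑y⁻¹ : GrpAlg G) * idem A m * (y : GrpAlg G) = idem A (σ m)) :
    Function.Injective σ := by
  intro m k hmk
  apply idem_injective
  have := h m
  rw [hmk, ← h k] at this
  simpa using this

/-- Each factor in the formula for this product can be undone by left multiplication, down to P_r ⊗
P_q. -/
lemma transform_mul_idem_ne_zero (x : CharGroup A → (GrpAlg G)ˣ) (l r q : CharGroup A) :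
    transform (bot_le : ⊥ ≤ A) (oneTwist G) x l * (idem A r ⊗ₜ[ℂ] idem A q) ≠ 0 := by
  intro h
  apply idem_tmul_idem_ne_zero r q
  rw [transform_oneTwist_mul] at h
  have h1 : (((x (l / q) : GrpAlg G)) ⊗ₜ[ℂ] (x l : GrpAlg G)) *
      (Delta G (↑(x l)⁻¹ : GrpAlg G) * (Delta G (x l : GrpAlg G) *
        (((↑(x (l / q))⁻¹ : GrpAlg G) * idem A r) ⊗ₜ[ℂ]
        ((↑(x l)⁻¹ : GrpAlg G) * idem A q)))) = 0 := by
    rw [h, mul_zero, mul_zero]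
  rw [← mul_assoc (Delta G _), ← map_mul, Units.inv_mul, map_one, one_mul,
    Algebra.TensorProduct.tmul_mul_tmul, Units.mul_inv_cancel_left,
    Units.mul_inv_cancel_left] at h1
  exact h1

variable [IsMulCommutative A]

lemma sum_idem_tmul_idem :
    ∑ r : CharGroup A, ∑ q : CharGroup A, idem A r ⊗ₜ[ℂ] idem A q = 1 := by
  simp only [← TensorProduct.tmul_sum, ← TensorProduct.sum_tmul, sum_idem]
  rfl

lemma ext_mul_idem_tmul {F F' : GrpAlg G ⊗[ℂ] GrpAlg G}
    (h : ∀ r q : CharGroup A, F * (idem A r ⊗ₜ[ℂ] idem A q) = F' * (idem A r ⊗ₜ[ℂ] idem A q)) :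
    F = F' := by
  rw [← mul_one F, ← mul_one F', ← sum_idem_tmul_idem (A := A)]
  simp only [Finset.mul_sum, h]

variable {x : CharGroup A → (GrpAlg G)ˣ} {σ : CharGroup A → CharGroup A → CharGroup A}

/-- Moving P_s to the right through x(l), and P_q, P_r to the left through the inverses of x(l), x(l
/ q), reduces the claim to the product of Δ(P_{σ(l, s)}) with a tensor of weight σ(l / q, r) * σ(l,
q). -/
lemma Delta_idem_mul_transform
    (hx : ∀ l m, (↑(x l)⁻¹ : GrpAlg G) * idem A m * (x l : GrpAlg G) = idem A (σ l m))
    (l s r q : CharGroup A) [Decidable (σ (l / q) r * σ l q = σ l s)] :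
    Delta G (idem A s) * (transform (bot_le : ⊥ ≤ A) (oneTwist G) x l *
        (idem A r ⊗ₜ[ℂ] idem A q)) =
      if σ (l / q) r * σ l q = σ l s then
        transform (bot_le : ⊥ ≤ A) (oneTwist G) x l * (idem A r ⊗ₜ[ℂ] idem A q) else 0 := by
  rw [transform_oneTwist_mul, ← mul_assoc, ← map_mul, mul_idem_of_conj (hx l s), map_mul,
    inv_mul_idem (hx l q), inv_mul_idem (hx (l / q) r), ← Algebra.TensorProduct.tmul_mul_tmul,
    mul_assoc, ← mul_assoc (Delta G (idem A (σ l s))), Delta_idem_mul]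
  split_ifs <;> simp

/-- The zero weight condition on the transform of `1 ⊗ 1` by a normalizing function is a cocycle
condition on the associated permutations. -/
lemma transform_zeroWeight_iff
    (hx : ∀ l m, (↑(x l)⁻¹ : GrpAlg G) * idem A m * (x l : GrpAlg G) = idem A (σ l m))
    (l : CharGroup A) :
    ZeroWeight₂ A (transform (bot_le : ⊥ ≤ A) (oneTwist G) x l) ↔
      ∀ r q, σ (l / q) r * σ l q = σ l (r * q) := by
  classical
  rw [zeroWeight₂_iff]
  constructor
  · intro h r q
    -- If the equation fails, Δ(P_{r * q}) annihilates F (P_r ⊗ P_q) from the left; but by zero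
    -- weight it can be moved past F, where it fixes P_r ⊗ P_q.
    by_contra hne
    have h1 := Delta_idem_mul_transform hx l (r * q) r q
    rw [if_neg hne, ← mul_assoc, h, mul_assoc, Delta_idem_mul, if_pos rfl] at h1
    exact transform_mul_idem_ne_zero x l r q h1
  · intro h s
    apply ext_mul_idem_tmul (A := A)
    intro r q
    rw [mul_assoc, mul_assoc, Delta_idem_mul_transform hx, Delta_idem_mul, h]
    simp only [(injective_of_conj (hx l)).eq_iff]
    split_ifs <;> simp

/-- The permutations attached to a normalizing vertex-IRF transformation form a coboundary. -/
lemma IsNormalizingVertexIRF.exists_realizes (hx : IsNormalizingVertexIRF A x) :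
    ∃ f, Realizes A x f := by
  choose σ hσ using fun l m => (hx.normalizes l).exists_idem m
  have hc := fun l => (transform_zeroWeight_iff hσ l).1 (hx.isVertexIRF.transform_zeroWeight l)
  -- The cocycle equation at r = l / m, q = m: it exhibits σ as the coboundary of f(l) = σ(l, l).
  have hf : ∀ l m, σ l m = σ l l / σ (l / m) (l / m) := by
    intro l m
    have := hc l (l / m) m
    rw [div_mul_cancel l m] at this
    rw [← this]
    exact (mul_div_cancel_left (σ (l / m) (l / m)) (σ l m)).symm
  refine ⟨fun l => σ l l, hx, ?_, fun l m => by rw [hσ, hf]⟩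
  rw [Finite.injective_iff_bijective.symm]
  intro l k hlk
  have h1 : σ l (l / k) = σ l 1 := by
    rw [hf, hf l 1, div_div_cancel l k, div_one l]
    simp only at hlk
    rw [hlk]
  have := injective_of_conj (hσ l) h1
  exact div_eq_one.1 this

lemma isNormalizingVertexIRF_of_conj {f : CharGroup A → CharGroup A}
    (hx : ∀ l m, (↑(x l)⁻¹ : GrpAlg G) * idem A m * (x l : GrpAlg G) =
      idem A (f l / f (l / m)))
    (hε : ∀ l, eps G (x l : GrpAlg G) = 1) :
    IsNormalizingVertexIRF A x := by
  refine ⟨⟨?_, hε, ?_⟩, ?_⟩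
  · intro l b hb
    rw [Subgroup.mem_bot] at hb
    subst hb
    rw [gpEl_one, one_mul, mul_one]
  · intro l
    rw [transform_zeroWeight_iff (σ := fun l m => f l / f (l / m)) hx]
    intro r q
    rw [div_div l q r, mul_comm q r, mul_comm (f (l / q) / f (l / (r * q)))]
    exact div_mul_div_cancel (f l) (f (l / q)) (f (l / (r * q)))
  · intro l
    exact memNormalizer_of_perm (Finite.injective_iff_bijective.1 (injective_of_conj (hx l)))
      (hx l)

end Transform

/-! ### The induced representations `Ind_A^G(m)` -/

section Ind

open Representation

lemma IndV.mk_mul {K : Subgroup G} {W : Type*} [AddCommGroup W] [Module ℂ W]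
    (ρ : Representation ℂ K W) (k : K) (h : G) (w : W) :
    IndV.mk K.subtype ρ ((k : G) * h) (ρ k w) = IndV.mk K.subtype ρ h w := by
  have := Coinvariants.mk_self_apply (Representation.tprod ((leftRegular ℂ G).comp K.subtype) ρ) k
    ((MonoidAlgebra.single h (1 : ℂ)) ⊗ₜ w)
  rw [Representation.tprod_apply, TensorProduct.map_tmul] at this
  rw [LinearMap.comp_apply, LinearMap.comp_apply, TensorProduct.mk_apply, TensorProduct.mk_apply,
    ← this]
  simp

/-- A `G`-equivariant linear map is `ℂ[G]`-linear. -/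
lemma asAlgebraHom_comm {U W : Type*} [AddCommGroup U] [Module ℂ U] [AddCommGroup W] [Module ℂ W]
    {τ : Representation ℂ G U} {σ : Representation ℂ G W} (φ : U →ₗ[ℂ] W)
    (hφ : ∀ g u, φ (τ g u) = σ g (φ u)) (h : GrpAlg G) (u : U) :
    φ (τ.asAlgebraHom h u) = σ.asAlgebraHom h (φ u) := by
  induction h using MonoidAlgebra.induction_on with
  | of g => rw [asAlgebraHom_of, asAlgebraHom_of, hφ]
  | add x y hx hy => simp only [map_add, LinearMap.add_apply, hx, hy]
  | smul r x hx => simp only [map_smul, LinearMap.smul_apply, hx]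

variable {A : Subgroup G}

/-- The generator `[1 ⊗ 1]` of `Ind_A^G(m)`. -/
def indGen (m : CharGroup A) : IndV A.subtype (charRep m) := IndV.mk A.subtype (charRep m) 1 1

lemma ind_indGen (m : CharGroup A) (a : A) :
    indChar A m (a : G) (indGen m) = ((m a : ℂˣ) : ℂ) • indGen m := by
  unfold indGen
  rw [indChar, ind_mk, ← map_smul, one_mul, ← IndV.mk_mul (charRep m) a]
  simp [charRep]

variable [Finite G]

lemma asAlgebraHom_idem_indGen (m : CharGroup A) :
    (indChar A m).asAlgebraHom (idem A m) (indGen m) = indGen m := by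
  classical
  rw [idem_mul_eq_smul (indChar A m) m m (ind_indGen m), if_pos rfl]

/-- The map `ℂ[G] ⊗ ℂ → ℂ[G]`, `h ⊗ c ↦ c h⁻¹ P_m`. -/
def indToAlgAux (m : CharGroup A) : GrpAlg G ⊗[ℂ] ℂ →ₗ[ℂ] GrpAlg G :=
  LinearMap.mulRight ℂ (idem A m) ∘ₗ HopfAlgebra.antipode ℂ ∘ₗ
    (TensorProduct.rid ℂ (GrpAlg G)).toLinearMap

lemma indToAlgAux_tmul (m : CharGroup A) (h : G) (c : ℂ) :
    indToAlgAux m (gpEl h ⊗ₜ c) = c • (gpEl h⁻¹ * idem A m) := by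
  simp [indToAlgAux, MonoidAlgebra.of_apply, -MonoidAlgebra.smul_single]

/-- The `G`-equivariant embedding `Ind_A^G(m) → ℂ[G]` with image the left ideal `ℂ[G] P_m`. -/
def indToAlg (m : CharGroup A) : IndV A.subtype (charRep m) →ₗ[ℂ] GrpAlg G :=
  Coinvariants.lift _ (indToAlgAux m) (fun a => by
    refine TensorProduct.ext (MonoidAlgebra.lhom_ext' fun h => LinearMap.ext_ring
      (LinearMap.ext fun c => ?_))
    change indToAlgAux m (Representation.leftRegular ℂ G (a : G) (gpEl h) ⊗ₜ charRep m a c) =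
      indToAlgAux m (gpEl h ⊗ₜ c)
    rw [leftRegular_apply, ← gpEl_mul, indToAlgAux_tmul, indToAlgAux_tmul, mul_inv_rev, gpEl_mul,
      mul_assoc, ← Subgroup.coe_inv, gpEl_mul_idem]
    simp [charRep, smul_smul, mul_comm _ c])

/-- The inverse is forced by the convention for `ind`: here g sends [h ⊗ c] to [h g⁻¹ ⊗ c], and h ↦
h⁻¹ turns this into left multiplication. -/
lemma indToAlg_mk (m : CharGroup A) (h : G) (c : ℂ) :
    indToAlg m (IndV.mk A.subtype (charRep m) h c) = c • (gpEl h⁻¹ * idem A m) :=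
  indToAlgAux_tmul m h c

lemma indToAlg_indGen (m : CharGroup A) : indToAlg m (indGen m) = idem A m := by
  rw [indGen, indToAlg_mk, inv_one, gpEl_one, one_mul, one_smul]

lemma indToAlg_mul_idem (m : CharGroup A) (z : IndV A.subtype (charRep m)) :
    indToAlg m z * idem A m = indToAlg m z := by
  suffices h : LinearMap.mulRight ℂ (idem A m) ∘ₗ indToAlg m = indToAlg m from
    LinearMap.congr_fun h z
  refine IndV.hom_ext _ _ fun h => LinearMap.ext fun c => ?_
  change indToAlg m (IndV.mk A.subtype (charRep m) h c) * idem A m =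
    indToAlg m (IndV.mk A.subtype (charRep m) h c)
  rw [indToAlg_mk, smul_mul_assoc, mul_assoc, idem_mul_self]

lemma indToAlg_ind (m : CharGroup A) (g : G) (z : IndV A.subtype (charRep m)) :
    indToAlg m (indChar A m g z) = gpEl g * indToAlg m z := by
  suffices h : indToAlg m ∘ₗ indChar A m g = LinearMap.mulLeft ℂ (gpEl g) ∘ₗ indToAlg m from
    LinearMap.congr_fun h z
  refine IndV.hom_ext _ _ fun h => LinearMap.ext fun c => ?_
  change indToAlg m (indChar A m g (IndV.mk A.subtype (charRep m) h c)) =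
    gpEl g * indToAlg m (IndV.mk A.subtype (charRep m) h c)
  rw [indChar, ind_mk, indToAlg_mk, indToAlg_mk, mul_smul_comm, ← mul_assoc, ← gpEl_mul,
    mul_inv_rev, inv_inv]

/-- Acting on the generator gives the inverse map ℂ[G] P_m → Ind_A^G(m). -/
lemma asAlgebraHom_indToAlg (m : CharGroup A) (z : IndV A.subtype (charRep m)) :
    (indChar A m).asAlgebraHom (indToAlg m z) (indGen m) = z := by
  suffices h : (LinearMap.applyₗ (indGen m) ∘ₗ (indChar A m).asAlgebraHom.toLinearMap) ∘ₗ
      indToAlg m = LinearMap.id from LinearMap.congr_fun h z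
  refine IndV.hom_ext _ _ fun h => LinearMap.ext fun c => ?_
  change (indChar A m).asAlgebraHom (indToAlg m (IndV.mk A.subtype (charRep m) h c)) (indGen m) =
    IndV.mk A.subtype (charRep m) h c
  rw [indToAlg_mk, map_smul, map_mul, LinearMap.smul_apply, Module.End.mul_apply,
    asAlgebraHom_idem_indGen, asAlgebraHom_of, indGen, indChar, ind_mk, inv_inv, one_mul,
    ← map_smul, smul_eq_mul, mul_one]

lemma indToAlg_asAlgebraHom (m : CharGroup A) (h : GrpAlg G) (z : IndV A.subtype (charRep m)) :
    indToAlg m ((indChar A m).asAlgebraHom h z) = h * indToAlg m z := by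
  rw [asAlgebraHom_comm (σ := leftRegular ℂ G) (indToAlg m) (fun g u => by
    rw [indToAlg_ind, leftRegular_apply]), leftRegular_asAlgebraHom_apply]

/-- `Ind_A^G(m)` and `Ind_A^G(k)` are isomorphic if and only if `P_m` and `P_k` are equivalent
idempotents. -/
lemma nonempty_indChar_equiv_iff (m k : CharGroup A) :
    Nonempty ((indChar A m).Equiv (indChar A k)) ↔
      ∃ u v : GrpAlg G, idem A m * u = u ∧ u * idem A k = u ∧ idem A k * v = v ∧
        v * idem A m = v ∧ u * v = idem A m ∧ v * u = idem A k := by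
  constructor
  · rintro ⟨F⟩
    have hF : ∀ h z, F ((indChar A m).asAlgebraHom h z) = (indChar A k).asAlgebraHom h (F z) :=
      asAlgebraHom_comm F.toLinearEquiv.toLinearMap fun g u =>
        LinearMap.congr_fun (F.isIntertwining' g) u
    have hF' : ∀ h z, F.symm ((indChar A k).asAlgebraHom h z) =
        (indChar A m).asAlgebraHom h (F.symm z) :=
      asAlgebraHom_comm F.symm.toLinearEquiv.toLinearMap fun g u =>
        LinearMap.congr_fun (F.symm.isIntertwining' g) u
    refine ⟨indToAlg k (F (indGen m)), indToAlg m (F.symm (indGen k)), ?_,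
      indToAlg_mul_idem _ _, ?_,
      indToAlg_mul_idem _ _, ?_, ?_⟩
    · rw [← indToAlg_asAlgebraHom, ← hF, asAlgebraHom_idem_indGen]
    · rw [← indToAlg_asAlgebraHom, ← hF', asAlgebraHom_idem_indGen]
    · rw [← indToAlg_asAlgebraHom, ← hF', asAlgebraHom_indToAlg, F.symm_apply_apply,
        indToAlg_indGen]
    · rw [← indToAlg_asAlgebraHom, ← hF, asAlgebraHom_indToAlg, F.apply_symm_apply,
        indToAlg_indGen]
  · rintro ⟨u, v, hu, -, hv, -, huv, hvu⟩
    refine ⟨Representation.Equiv.mk (LinearEquiv.ofLinearMap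
      ((LinearMap.applyₗ (indGen k) ∘ₗ (indChar A k).asAlgebraHom.toLinearMap) ∘ₗ
        LinearMap.mulRight ℂ u ∘ₗ indToAlg m)
      ((LinearMap.applyₗ (indGen m) ∘ₗ (indChar A m).asAlgebraHom.toLinearMap) ∘ₗ
        LinearMap.mulRight ℂ v ∘ₗ indToAlg k)
      (LinearMap.ext fun z => ?_) (LinearMap.ext fun z => ?_)) fun g => LinearMap.ext fun z => ?_⟩
    · change (indChar A k).asAlgebraHom (indToAlg m ((indChar A m).asAlgebraHom
        (indToAlg k z * v) (indGen m)) * u) (indGen k) = z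
      rw [indToAlg_asAlgebraHom, indToAlg_indGen, mul_assoc, hu, mul_assoc, hvu,
        indToAlg_mul_idem, asAlgebraHom_indToAlg]
    · change (indChar A m).asAlgebraHom (indToAlg k ((indChar A k).asAlgebraHom
        (indToAlg m z * u) (indGen k)) * v) (indGen m) = z
      rw [indToAlg_asAlgebraHom, indToAlg_indGen, mul_assoc, hv, mul_assoc, huv,
        indToAlg_mul_idem, asAlgebraHom_indToAlg]
    · change (indChar A k).asAlgebraHom (indToAlg m (indChar A m g z) * u) (indGen k) =
        indChar A k g ((indChar A k).asAlgebraHom (indToAlg m z * u) (indGen k))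
      rw [indToAlg_ind, mul_assoc, map_mul, asAlgebraHom_of]
      rfl

/-- The counit takes the same value on u v and v u, and among the P_m it is nonzero only on the one
of trivial character. -/
lemma eq_one_iff_of_indChar_equiv {m k : CharGroup A}
    (h : Nonempty ((indChar A m).Equiv (indChar A k))) : m = 1 ↔ k = 1 := by
  classical
  obtain ⟨u, v, -, -, -, -, huv, hvu⟩ := (nonempty_indChar_equiv_iff m k).1 h
  have h1 : eps G (idem A m) = eps G (idem A k) := by
    rw [← huv, ← hvu, map_mul, map_mul, mul_comm]
  rw [eps_idem, eps_idem] at h1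
  by_cases hm : m = 1 <;> by_cases hk : k = 1 <;> simp_all

variable [IsMulCommutative A]

lemma exists_realizes_iff (f : CharGroup A → CharGroup A) :
    (∃ x : CharGroup A → (GrpAlg G)ˣ, Realizes A x f) ↔
      ∀ l m : CharGroup A, Nonempty
        ((indChar A (l / m)).Equiv (indChar A (f l / f m))) := by
  classical
  constructor
  · rintro ⟨x, hx⟩ l m
    have h := hx.perm l (l / m)
    rw [div_div_cancel l m] at h
    have h1 := inv_mul_idem h
    have h2 := mul_idem_of_conj h
    -- With P = P_{l / m} and Q = x(l)⁻¹ P x(l), the pair u = P x(l), v = x(l)⁻¹ P is an equivalence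
    -- between P and Q.
    refine (nonempty_indChar_equiv_iff _ _).2 ⟨idem A (l / m) * (x l : GrpAlg G),
      (↑(x l)⁻¹ : GrpAlg G) * idem A (l / m), ?_, ?_, ?_, ?_, ?_, ?_⟩
    · rw [← mul_assoc, idem_mul_self]
    · rw [mul_assoc, ← h2, ← mul_assoc, idem_mul_self]
    · rw [← mul_assoc, ← h1, mul_assoc, idem_mul_self]
    · rw [mul_assoc, idem_mul_self]
    · rw [mul_assoc, Units.mul_inv_cancel_left, idem_mul_self]
    · rw [← h]
      simp only [mul_assoc]
      rw [← mul_assoc (idem A (l / m)), idem_mul_self]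
  · intro h
    have hf : Function.Injective f := by
      intro l m hlm
      have h1 := eq_one_iff_of_indChar_equiv (h l m)
      rw [hlm, div_self' (f m)] at h1
      exact div_eq_one.1 (h1.2 rfl)
    have h' : ∀ l m : CharGroup A, Nonempty
        ((indChar A m).Equiv (indChar A (f l / f (l / m)))) := by
      intro l m
      have := h l (l / m)
      rwa [div_div_cancel l m] at this
    choose u v hu hu' hv hv' huv hvu using fun l m => (nonempty_indChar_equiv_iff _ _).1 (h' l m)
    have hinj : ∀ l, Function.Injective fun m => f l / f (l / m) := by
      intro l m k hmk
      exact div_right_injective (G := CharGroup A) (hf (div_right_injective hmk))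
    have hsum : ∀ l, ∑ m, idem A (f l / f (l / m)) = 1 := by
      intro l
      rw [← sum_idem A]
      exact Fintype.sum_bijective _ (Finite.injective_iff_bijective.1 (hinj l)) _ _ fun _ => rfl
    have huv0 : ∀ l m k, m ≠ k → u l m * v l k = 0 := by
      intro l m k hmk
      rw [← hu' l m, ← hv l k, mul_assoc, ← mul_assoc (idem A _),
        idem_mul_idem_of_ne ((hinj l).ne hmk), zero_mul, mul_zero]
    have hvu0 : ∀ l m k, m ≠ k → v l m * u l k = 0 := by
      intro l m k hmk
      rw [← hv' l m, ← hu l k, mul_assoc, ← mul_assoc (idem A _),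
        idem_mul_idem_of_ne hmk, zero_mul, mul_zero]
    -- Cross terms vanish because distinct source idempotents, and distinct target idempotents, are
    -- orthogonal. The diagonal terms add up to 1 here over the sources, and below over the targets,
    -- which exhaust all P_k.
    have hUV : ∀ l, (∑ m, u l m) * ∑ m, v l m = 1 := by
      intro l
      rw [← sum_idem A, Finset.sum_mul]
      refine Finset.sum_congr rfl fun m _ => ?_
      rw [Finset.mul_sum, Finset.sum_eq_single m (fun k _ hk => huv0 l m k hk.symm) (by simp), huv]
    have hVU : ∀ l, (∑ m, v l m) * ∑ m, u l m = 1 := by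
      intro l
      rw [← hsum l, Finset.sum_mul]
      refine Finset.sum_congr rfl fun m _ => ?_
      rw [Finset.mul_sum, Finset.sum_eq_single m (fun k _ hk => hvu0 l m k hk.symm) (by simp), hvu]
    let y : CharGroup A → (GrpAlg G)ˣ := fun l => ⟨_, _, hUV l, hVU l⟩
    have hy : ∀ l m, (↑(y l)⁻¹ : GrpAlg G) * idem A m * (y l : GrpAlg G) =
        idem A (f l / f (l / m)) := by
      intro l m
      change (∑ m, v l m) * idem A m * ∑ m, u l m = _
      have h1 : (∑ m, v l m) * idem A m = v l m := by
        rw [Finset.sum_mul, Finset.sum_eq_single m _ (by simp), hv']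
        intro k _ hk
        rw [← hv' l k, mul_assoc, idem_mul_idem_of_ne hk, mul_zero]
      rw [h1, Finset.mul_sum, Finset.sum_eq_single m (fun k _ hk => hvu0 l m k hk.symm) (by simp),
        hvu]
    -- Rescaling by the counit of the unit gives ε(x(l)) = 1 and leaves conjugation unchanged.
    let c : CharGroup A → ℂˣ := fun l => Units.map (eps G : GrpAlg G →* ℂ) (y l)
    let x : CharGroup A → (GrpAlg G)ˣ := fun l =>
      Units.map (algebraMap ℂ (GrpAlg G) : ℂ →* GrpAlg G) (c l)⁻¹ * y l
    have hx : ∀ l m, (↑(x l)⁻¹ : GrpAlg G) * idem A m * (x l : GrpAlg G) =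
        idem A (f l / f (l / m)) := by
      intro l m
      rw [← hy l m]
      have h1 : (x l : GrpAlg G) = ((c l : ℂ))⁻¹ • (y l : GrpAlg G) := by
        simp [x, Algebra.smul_def]
      have h2 : (↑(x l)⁻¹ : GrpAlg G) = (c l : ℂ) • (↑(y l)⁻¹ : GrpAlg G) := by
        rw [Algebra.smul_def, Algebra.commutes]
        simp [x]
      rw [h1, h2, smul_mul_assoc, smul_mul_assoc, mul_smul_comm, smul_smul,
        mul_inv_cancel₀ (c l).ne_zero, one_smul]
    refine ⟨x, isNormalizingVertexIRF_of_conj hx fun l => ?_,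
      Finite.injective_iff_bijective.1 hf, hx⟩
    have h1 : (x l : GrpAlg G) = ((c l : ℂ))⁻¹ • (y l : GrpAlg G) := by
      simp [x, Algebra.smul_def]
    rw [h1, map_smul]
    exact inv_mul_cancel₀ (c l).ne_zero

end Ind

/-! ### The action of `ℂ[G] ⊗ ℂ[G]` on tensor products -/

section Action

variable {U W : Type u} [AddCommGroup U] [Module ℂ U] [AddCommGroup W] [Module ℂ W]
  (τ : Representation ℂ G U) (σ : Representation ℂ G W)

lemma act₂_tmul (a b : GrpAlg G) (u : U) (w : W) :
    act₂ τ σ (a ⊗ₜ b) (u ⊗ₜ w) = τ.asAlgebraHom a u ⊗ₜ σ.asAlgebraHom b w := rfl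

lemma act₂_Delta (h : GrpAlg G) : act₂ τ σ (Delta G h) = (τ.tprod σ).asAlgebraHom h := by
  induction h using MonoidAlgebra.induction_on with
  | of g =>
    rw [Delta_gpEl, Representation.asAlgebraHom_of]
    refine TensorProduct.ext' fun u w => ?_
    rw [act₂_tmul, Representation.asAlgebraHom_of, Representation.asAlgebraHom_of,
      Representation.tprod_apply, TensorProduct.map_tmul]
  | add x y hx hy => simp only [map_add, hx, hy]
  | smul r x hx => simp only [map_smul, hx]

lemma act₂_leftRegular (F F' : GrpAlg G ⊗[ℂ] GrpAlg G) :
    act₂ (Representation.leftRegular ℂ G) (Representation.leftRegular ℂ G) F F' = F * F' := by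
  suffices h : (act₂ (Representation.leftRegular ℂ G)
      (Representation.leftRegular ℂ G)).toLinearMap =
        (Algebra.lmul ℂ (GrpAlg G ⊗[ℂ] GrpAlg G)).toLinearMap from
    LinearMap.congr_fun (LinearMap.congr_fun h F) F'
  refine TensorProduct.ext' fun a b => TensorProduct.ext' fun c d => ?_
  change act₂ _ _ (a ⊗ₜ b) (c ⊗ₜ d) = (a ⊗ₜ b) * (c ⊗ₜ d)
  rw [act₂_tmul, leftRegular_asAlgebraHom_apply, leftRegular_asAlgebraHom_apply,
    Algebra.TensorProduct.tmul_mul_tmul]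

lemma act₂_mem_weightSpace {A : Subgroup G} {F : GrpAlg G ⊗[ℂ] GrpAlg G}
    (hF : ZeroWeight₂ A F) {m n : CharGroup A} {v : U} {w : W} (hv : v ∈ weightSpace A τ m)
    (hw : w ∈ weightSpace A σ n) :
    act₂ τ σ F (v ⊗ₜ w) ∈ weightSpace A (τ.tprod σ) (m * n) := by
  intro a
  rw [← Representation.asAlgebraHom_of, ← act₂_Delta, ← Module.End.mul_apply, ← map_mul,
    hF a a.2, map_mul, Module.End.mul_apply, Delta_gpEl, act₂_tmul, Representation.asAlgebraHom_of,
    Representation.asAlgebraHom_of, hv a, hw a, TensorProduct.smul_tmul_smul, map_smul]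
  simp

lemma transform_mul_left_inv [Finite G] {A : Subgroup G} (x : CharGroup A → (GrpAlg G)ˣ)
    (l : CharGroup A) :
    Delta G (↑(x l)⁻¹ : GrpAlg G) * transform (bot_le : ⊥ ≤ A) (oneTwist G) x l =
      ∑ q : CharGroup A, (↑(x (l / q))⁻¹ : GrpAlg G) ⊗ₜ ((↑(x l)⁻¹ : GrpAlg G) * idem A q) := by
  unfold transform oneTwist
  rw [mul_one, mul_assoc, ← mul_assoc, ← map_mul, Units.inv_mul, map_one, one_mul,
    Finset.mul_sum]
  simp

/-- On a second factor of weight l / m only the summand q = l / m survives, and l / q = m. Thus the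
operators x⁻¹ convert J into the plain tensor product, which is the source of all exchange relations
below. -/
lemma act₂_transform [Finite G] {A : Subgroup G} [IsMulCommutative A]
    (x : CharGroup A → (GrpAlg G)ˣ) (l m : CharGroup A) (v : U) {w : W}
    (hw : w ∈ weightSpace A σ (l / m)) :
    (τ.tprod σ).asAlgebraHom (↑(x l)⁻¹ : GrpAlg G)
        (act₂ τ σ (transform (bot_le : ⊥ ≤ A) (oneTwist G) x l) (v ⊗ₜ w)) =
      τ.asAlgebraHom (↑(x m)⁻¹ : GrpAlg G) v ⊗ₜ σ.asAlgebraHom (↑(x l)⁻¹ : GrpAlg G) w := by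
  classical
  rw [← act₂_Delta, ← Module.End.mul_apply, ← map_mul, transform_mul_left_inv, map_sum,
    LinearMap.sum_apply, Finset.sum_eq_single (l / m)]
  · rw [act₂_tmul, map_mul, Module.End.mul_apply, asAlgebraHom_idem_of_mem σ hw, if_pos rfl,
      div_div_cancel l m]
  · intro q _ hq
    rw [act₂_tmul, map_mul, Module.End.mul_apply, asAlgebraHom_idem_of_mem σ hw, if_neg hq.symm,
      map_zero, TensorProduct.tmul_zero]
  · simp

end Action

/-! ### The one-dimensional dynamical data with `K = A` -/

section OneDim

open Representation

lemma nonempty_ind_equiv {K : Subgroup G} {V W : Type*} [AddCommGroup V] [Module ℂ V]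
    [AddCommGroup W] [Module ℂ W] {ρ : Representation ℂ K V} {σ : Representation ℂ K W}
    (e : V ≃ₗ[ℂ] W) (he : ∀ k v, e (ρ k v) = σ k (e v)) :
    Nonempty ((ind K.subtype ρ).Equiv (ind K.subtype σ)) := by
  have he' : ∀ k w, e.symm (σ k w) = ρ k (e.symm w) := by
    intro k w
    rw [LinearEquiv.symm_apply_eq, he, LinearEquiv.apply_symm_apply]
  let F : IndV K.subtype ρ →ₗ[ℂ] IndV K.subtype σ := Coinvariants.map _ _
    ⟨e.toLinearMap.lTensor _, fun k => TensorProduct.ext' fun h v => by simp [he]⟩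
  let F' : IndV K.subtype σ →ₗ[ℂ] IndV K.subtype ρ := Coinvariants.map _ _
    ⟨e.symm.toLinearMap.lTensor _, fun k => TensorProduct.ext' fun h v => by simp [he']⟩
  have hF : ∀ g v, F (IndV.mk _ ρ g v) = IndV.mk _ σ g (e v) := fun g v => rfl
  have hF' : ∀ g v, F' (IndV.mk _ σ g v) = IndV.mk _ ρ g (e.symm v) := fun g v => rfl
  refine ⟨Representation.Equiv.mk (LinearEquiv.ofLinearMap F F'
    (IndV.hom_ext _ _ fun g => LinearMap.ext fun v => ?_)
    (IndV.hom_ext _ _ fun g => LinearMap.ext fun v => ?_)) fun h =>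
      IndV.hom_ext _ _ fun g => LinearMap.ext fun v => ?_⟩
  · change F (F' (IndV.mk _ σ g v)) = IndV.mk _ σ g v
    rw [hF', hF, LinearEquiv.apply_symm_apply]
  · change F' (F (IndV.mk _ ρ g v)) = IndV.mk _ ρ g v
    rw [hF, hF', LinearEquiv.symm_apply_apply]
  · change F (ind _ ρ h (IndV.mk _ ρ g v)) = ind _ σ h (F (IndV.mk _ ρ g v))
    rw [ind_mk, hF, hF, ind_mk]

variable {A : Subgroup G}

/-- `A` acting by scalars through the character `m`. -/
def scalarRep (m : CharGroup A) (V : Type*) [AddCommGroup V] [Module ℂ V] :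
    Representation ℂ A V where
  toFun a := ((m a : ℂˣ) : ℂ) • 1
  map_one' := by simp
  map_mul' a b := by rw [map_mul, Units.val_mul, smul_mul_smul_comm, one_mul]

lemma scalarRep_apply (m : CharGroup A) (V : Type*) [AddCommGroup V] [Module ℂ V] (a : A)
    (v : V) : scalarRep m V a v = ((m a : ℂˣ) : ℂ) • v := rfl

/-- The dynamical datum with `K = A` and `V_l` one-dimensional of character `f l`. -/
abbrev oneDimDatum (f : CharGroup A → CharGroup A)
    (hf : ∀ l m : CharGroup A, Nonempty ((indChar A (l / m)).Equiv (indChar A (f l / f m)))) :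
    DynamicalDatum A where
  K := A
  V _ := ℂ
  ρ l a := LinearEquiv.smulOfUnit (f l a)
  projective l g h := ⟨1, fun v => by
    simp [LinearEquiv.smulOfUnit, Units.smul_def, mul_assoc]⟩
  nontrivial _ := inferInstance
  irreducible _ W _ := eq_bot_or_eq_top W
  lin l m := scalarRep (f l / f m) _
  lin_apply l m a := by
    refine TensorProduct.ext' fun c φ => ?_
    have h : (LinearEquiv.smulOfUnit (f m a)).symm.toLinearMap.dualMap φ =
        (((f m a)⁻¹ : ℂˣ) : ℂ) • φ :=
      LinearMap.ext fun d => by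
        change φ ((f m a)⁻¹ • d) = (((f m a)⁻¹ : ℂˣ) : ℂ) • φ d
        rw [Units.smul_def, map_smul]
    rw [scalarRep_apply, TensorProduct.map_tmul, h, TensorProduct.tmul_smul,
      TensorProduct.smul_tmul']
    change _ = _ • ((((f l a : ℂˣ) : ℂ) • c) ⊗ₜ φ)
    rw [← TensorProduct.smul_tmul', ← TensorProduct.smul_tmul', smul_smul]
    congr 1
    rw [mul_comm, ← Units.val_mul, ← div_eq_mul_inv]
    rfl
  ind_equiv l m := by
    obtain ⟨e⟩ := hf l m
    obtain ⟨e'⟩ := nonempty_ind_equiv (K := A) (σ := charRep (f l / f m))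
      (ρ := scalarRep (f l / f m) (ℂ ⊗[ℂ] Module.Dual ℂ ℂ))
      ((TensorProduct.lid ℂ _).trans (LinearMap.ringLmapEquivSelf ℂ ℂ ℂ))
      (fun k v => by rw [scalarRep_apply, map_smul]; rfl)
    exact ⟨e'.trans e.symm⟩

/-- A map out of a line is the image of its basis vector, and equivariance prescribes the weight of
that vector. -/
lemma mem_homK_oneDimDatum {f : CharGroup A → CharGroup A}
    (hf : ∀ l m : CharGroup A, Nonempty ((indChar A (l / m)).Equiv (indChar A (f l / f m))))
    {U : Type u} [AddCommGroup U] [Module ℂ U] (τ : Representation ℂ G U) {l m : CharGroup A}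
    (φ : ℂ →ₗ[ℂ] ℂ ⊗[ℂ] U) :
    φ ∈ (oneDimDatum f hf).homK τ l m ↔
      TensorProduct.lid ℂ U (φ 1) ∈ weightSpace A τ (f l / f m) := by
  obtain ⟨u, rfl⟩ : ∃ u : U, φ = LinearMap.toSpanSingleton ℂ _ ((1 : ℂ) ⊗ₜ u) :=
    ⟨TensorProduct.lid ℂ U (φ 1), LinearMap.ext_ring (by
      rw [LinearMap.toSpanSingleton_apply, one_smul]
      apply (TensorProduct.lid ℂ U).injective
      simp)⟩
  have h1 : ∀ (a : A) (c : ℂ), TensorProduct.map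
      (LinearEquiv.smulOfUnit (R := ℂ) (f m a) : ℂ ≃ₗ[ℂ] ℂ).toLinearMap (τ (a : G))
        (c • ((1 : ℂ) ⊗ₜ[ℂ] u)) = c • ((f m a : ℂˣ) : ℂ) • ((1 : ℂ) ⊗ₜ[ℂ] τ (a : G) u) := by
    intro a c
    rw [map_smul, TensorProduct.map_tmul]
    change c • ((((f m a : ℂˣ) : ℂ) • (1 : ℂ)) ⊗ₜ[ℂ] τ (a : G) u) = _
    rw [← TensorProduct.smul_tmul']
  have h2 : (LinearMap.toSpanSingleton ℂ _ ((1 : ℂ) ⊗ₜ u) : ℂ →ₗ[ℂ] ℂ ⊗[ℂ] U) ∈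
      (oneDimDatum f hf).homK τ l m ↔ ∀ (a : A) (c : ℂ),
        (((f l a : ℂˣ) : ℂ) * c) • ((1 : ℂ) ⊗ₜ[ℂ] u) =
          c • ((f m a : ℂˣ) : ℂ) • ((1 : ℂ) ⊗ₜ[ℂ] τ (a : G) u) := by
    simp only [← h1]
    rfl
  have h3 : ∀ a : A, ((((f l / f m) a : ℂˣ)) : ℂ) =
      ((f m a : ℂˣ) : ℂ)⁻¹ * ((f l a : ℂˣ) : ℂ) := by
    intro a
    rw [MonoidHom.div_apply, Units.val_div_eq_div_val, div_eq_inv_mul]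
  rw [h2, LinearMap.toSpanSingleton_apply, one_smul, TensorProduct.lid_tmul, one_smul]
  constructor
  · intro h a
    have := congrArg (TensorProduct.lid ℂ U) (h a 1)
    simp only [map_smul, TensorProduct.lid_tmul, one_smul, mul_one] at this
    rw [h3, mul_smul, this, inv_smul_smul₀ (f m a).ne_zero]
  · intro h a c
    rw [h a, h3, TensorProduct.tmul_smul, smul_smul, smul_smul, mul_assoc,
      mul_inv_cancel_left₀ (f m a).ne_zero, mul_comm]

/-- The map `u ↦ (c ↦ c ⊗ y⁻¹ u)`. -/
def unitHomEquiv (y : (GrpAlg G)ˣ) {U : Type u} [AddCommGroup U] [Module ℂ U]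
    (τ : Representation ℂ G U) : U ≃ₗ[ℂ] (ℂ →ₗ[ℂ] ℂ ⊗[ℂ] U) :=
  (LinearEquiv.ofLinearMap (τ.asAlgebraHom (↑y⁻¹ : GrpAlg G)) (τ.asAlgebraHom (y : GrpAlg G))
    (by
      change _ * _ = (1 : Module.End ℂ U)
      rw [← map_mul, Units.inv_mul, map_one])
    (by
      change _ * _ = (1 : Module.End ℂ U)
      rw [← map_mul, Units.mul_inv, map_one]) : U ≃ₗ[ℂ] U).trans
    ((TensorProduct.lid ℂ U).symm.trans (LinearMap.ringLmapEquivSelf ℂ ℂ (ℂ ⊗[ℂ] U)).symm)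

lemma unitHomEquiv_apply_one (y : (GrpAlg G)ˣ) {U : Type u} [AddCommGroup U] [Module ℂ U]
    (τ : Representation ℂ G U) (u : U) :
    unitHomEquiv y τ u 1 = 1 ⊗ₜ τ.asAlgebraHom (↑y⁻¹ : GrpAlg G) u := by
  simp [unitHomEquiv]

variable [Finite G] [IsMulCommutative A] {x : CharGroup A → (GrpAlg G)ˣ}
  {f : CharGroup A → CharGroup A}

/-- Immediate from x(l)⁻¹ P_{l / m} = P_{f(l) / f(m)} x(l)⁻¹. -/
lemma Realizes.inv_mem_weightSpace (hx : Realizes A x f) {U : Type u} [AddCommGroup U]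
    [Module ℂ U] (τ : Representation ℂ G U) {l m : CharGroup A} {u : U}
    (hu : u ∈ weightSpace A τ (l / m)) :
    τ.asAlgebraHom (↑(x l)⁻¹ : GrpAlg G) u ∈ weightSpace A τ (f l / f m) := by
  have h := inv_mul_idem (hx.perm l (l / m))
  rw [div_div_cancel l m] at h
  rw [mem_weightSpace_iff] at hu ⊢
  rw [← Module.End.mul_apply, ← map_mul, ← h, map_mul, Module.End.mul_apply, hu]

lemma Realizes.mem_weightSpace (hx : Realizes A x f) {U : Type u} [AddCommGroup U]
    [Module ℂ U] (τ : Representation ℂ G U) {l m : CharGroup A} {u : U}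
    (hu : u ∈ weightSpace A τ (f l / f m)) :
    τ.asAlgebraHom (x l : GrpAlg G) u ∈ weightSpace A τ (l / m) := by
  have h := mul_idem_of_conj (hx.perm l (l / m))
  rw [div_div_cancel l m] at h
  rw [mem_weightSpace_iff] at hu ⊢
  rw [← Module.End.mul_apply, ← map_mul, h, map_mul, Module.End.mul_apply, hu]

lemma Realizes.map_weightSpace (hx : Realizes A x f)
    (hf : ∀ l m : CharGroup A, Nonempty ((indChar A (l / m)).Equiv (indChar A (f l / f m))))
    {U : Type u} [AddCommGroup U] [Module ℂ U] (τ : Representation ℂ G U) (l m : CharGroup A) :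
    (weightSpace A τ (l / m)).map (unitHomEquiv (x l) τ).toLinearMap =
      (oneDimDatum f hf).homK τ l m := by
  have key : ∀ u, unitHomEquiv (x l) τ u ∈ (oneDimDatum f hf).homK τ l m ↔
      u ∈ weightSpace A τ (l / m) := by
    intro u
    rw [mem_homK_oneDimDatum hf τ, unitHomEquiv_apply_one, TensorProduct.lid_tmul, one_smul]
    refine ⟨fun h => ?_, hx.inv_mem_weightSpace τ⟩
    have := hx.mem_weightSpace τ h
    rwa [← Module.End.mul_apply, ← map_mul, Units.mul_inv, map_one, Module.End.one_apply] at this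
  ext φ
  rw [Submodule.mem_map]
  constructor
  · rintro ⟨u, hu, rfl⟩
    exact (key u).2 hu
  · intro h
    obtain ⟨u, rfl⟩ := (unitHomEquiv (x l) τ).surjective φ
    exact ⟨u, (key u).1 h, rfl⟩

/-- The exchange isomorphisms `u ↦ x(l)⁻¹ u` for the one-dimensional dynamical datum. -/
def Realizes.exchangeSystem (hx : Realizes A x f)
    (hf : ∀ l m : CharGroup A, Nonempty ((indChar A (l / m)).Equiv (indChar A (f l / f m)))) :
    ExchangeSystem (oneDimDatum f hf) where
  Ψ τ l m := (unitHomEquiv (x l) τ).ofSubmodules _ _ (hx.map_weightSpace hf τ l m)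
  natural {U U'} _ _ _ _ _ _ τ τ' φ l m v v' hv := by
    refine LinearMap.ext_ring ?_
    change unitHomEquiv (x l) τ' (v' : U') 1 =
      φ.toLinearMap.lTensor ℂ (unitHomEquiv (x l) τ (v : U) 1)
    rw [unitHomEquiv_apply_one, unitHomEquiv_apply_one, LinearMap.lTensor_tmul, hv]
    congr 1
    exact (asAlgebraHom_comm φ.toLinearMap
      (fun g u => LinearMap.congr_fun (φ.isIntertwining' g) u) _ _).symm

lemma Realizes.corresponds (hx : Realizes A x f)
    (hf : ∀ l m : CharGroup A, Nonempty ((indChar A (l / m)).Equiv (indChar A (f l / f m))))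
    {J : CharGroup A → GrpAlg G ⊗[ℂ] GrpAlg G}
    (hJ : ∀ l, J l = transform (bot_le : ⊥ ≤ A) (oneTwist G) x l) :
    Corresponds J (oneDimDatum f hf) := by
  refine ⟨hx.exchangeSystem hf, fun U W _ _ _ _ _ _ τ σ l m n v w => ?_⟩
  have hz : act₂ τ σ (J l) ((v : U) ⊗ₜ[ℂ] (w : W)) ∈ weightSpace A (τ.tprod σ) (l / n) := by
    have h := act₂_mem_weightSpace τ σ
      (hx.isNormalizingVertexIRF.isVertexIRF.transform_zeroWeight l) v.2 w.2
    rw [mul_comm (m / n), div_mul_div_cancel l m n] at h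
    rw [hJ]
    exact h
  refine ⟨⟨_, hz⟩, rfl, LinearMap.ext_ring ?_⟩
  change unitHomEquiv (x l) (τ.tprod σ) (act₂ τ σ (J l) ((v : U) ⊗ₜ[ℂ] (w : W))) 1 =
    TensorProduct.assoc ℂ ℂ U W ((unitHomEquiv (x m) τ (v : U)).rTensor W
      (unitHomEquiv (x l) σ (w : W) 1))
  rw [hJ, unitHomEquiv_apply_one, unitHomEquiv_apply_one, LinearMap.rTensor_tmul,
    unitHomEquiv_apply_one, act₂_transform τ σ x l m _ w.2, TensorProduct.assoc_tmul]

end OneDim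

/-! ### The dimension of an induced representation -/

section IndDimension

open Representation

variable (K : Subgroup G) {V : Type*} [AddCommGroup V] [Module ℂ V] (ρ : Representation ℂ K V)

/-- The set of right cosets `K \ G`. -/
abbrev RightCosets : Type u := Quotient (QuotientGroup.rightRel K)

lemma mul_out_inv_mem (h : G) :
    h * (Quotient.out (Quotient.mk (QuotientGroup.rightRel K) h))⁻¹ ∈ K :=
  QuotientGroup.rightRel_apply.1 (Quotient.mk_out (s := QuotientGroup.rightRel K) h)

/-- The component in `K` of a group element, for the chosen representatives of the right cosets. -/
def cosetPart (h : G) : K :=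
  ⟨h * (Quotient.out (Quotient.mk (QuotientGroup.rightRel K) h))⁻¹, mul_out_inv_mem K h⟩

lemma cosetPart_mul_out (h : G) :
    (cosetPart K h : G) * Quotient.out (Quotient.mk (QuotientGroup.rightRel K) h) = h := by
  simp [cosetPart]

lemma mk_mul_left (k : K) (h : G) :
    Quotient.mk (QuotientGroup.rightRel K) ((k : G) * h) =
      Quotient.mk (QuotientGroup.rightRel K) h :=
  Quotient.sound (QuotientGroup.rightRel_apply.2 (by simp))

lemma cosetPart_mul (k : K) (h : G) : cosetPart K ((k : G) * h) = k * cosetPart K h := by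
  apply Subtype.ext
  simp only [cosetPart, mk_mul_left, Subgroup.coe_mul, mul_assoc]

lemma cosetPart_out (q : RightCosets K) : cosetPart K (Quotient.out q) = 1 := by
  apply Subtype.ext
  simp [cosetPart]

open Classical in
/-- The map `ℂ[G] ⊗ V → ⨁_{K \ G} V` inducing the decomposition of `Ind_K^G V`. -/
def indToFunAux : GrpAlg G ⊗[ℂ] V →ₗ[ℂ] (RightCosets K → V) :=
  TensorProduct.lift ((Finsupp.linearCombination ℂ fun h : G =>
    LinearMap.single ℂ (fun _ : RightCosets K => V) (Quotient.mk _ h) ∘ₗ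
      ρ (cosetPart K h)⁻¹) ∘ₗ (MonoidAlgebra.coeffLinearEquiv ℂ).toLinearMap)

open Classical in
lemma indToFunAux_tmul (h : G) (v : V) :
    indToFunAux K ρ (gpEl h ⊗ₜ v) =
      Pi.single (Quotient.mk (QuotientGroup.rightRel K) h) (ρ (cosetPart K h)⁻¹ v) := by
  simp [indToFunAux, MonoidAlgebra.of_apply]

/-- The decomposition of `Ind_K^G V` along the right cosets of `K`. -/
def indToFun : IndV K.subtype ρ →ₗ[ℂ] (RightCosets K → V) :=
  Coinvariants.lift _ (indToFunAux K ρ) fun k => by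
    refine TensorProduct.ext (MonoidAlgebra.lhom_ext' fun h => LinearMap.ext_ring
      (LinearMap.ext fun v => ?_))
    change indToFunAux K ρ (Representation.leftRegular ℂ G (k : G) (gpEl h) ⊗ₜ ρ k v) =
      indToFunAux K ρ (gpEl h ⊗ₜ v)
    rw [leftRegular_apply, ← gpEl_mul, indToFunAux_tmul, indToFunAux_tmul, mk_mul_left,
      cosetPart_mul, mul_inv_rev, map_mul, Module.End.mul_apply, inv_self_apply]

open Classical in
lemma indToFun_mk (h : G) (v : V) :
    indToFun K ρ (IndV.mk K.subtype ρ h v) =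
      Pi.single (Quotient.mk (QuotientGroup.rightRel K) h) (ρ (cosetPart K h)⁻¹ v) :=
  indToFunAux_tmul K ρ h v

variable [Finite G]

instance : Fintype (RightCosets K) := Fintype.ofFinite _

/-- The decomposition of `Ind_K^G V` along the right cosets of `K`, as an equivalence. -/
def indEquivFun : IndV K.subtype ρ ≃ₗ[ℂ] (RightCosets K → V) :=
  LinearEquiv.ofLinearMap (indToFun K ρ)
    (∑ q : RightCosets K, IndV.mk K.subtype ρ (Quotient.out q) ∘ₗ LinearMap.proj q)
    (by
      classical
      refine LinearMap.pi_ext fun q v => ?_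
      rw [LinearMap.comp_apply, LinearMap.sum_apply, Finset.sum_eq_single q]
      · rw [LinearMap.comp_apply, LinearMap.proj_apply, Pi.single_eq_same, indToFun_mk,
          cosetPart_out, inv_one, map_one, Module.End.one_apply, Quotient.out_eq,
          LinearMap.id_apply]
      · intro r _ hr
        simp [Pi.single_eq_of_ne hr]
      · simp)
    (by
      classical
      refine IndV.hom_ext _ _ fun h => LinearMap.ext fun v => ?_
      change (∑ q : RightCosets K, IndV.mk K.subtype ρ (Quotient.out q) ∘ₗ LinearMap.proj q)
        (indToFun K ρ (IndV.mk K.subtype ρ h v)) = IndV.mk K.subtype ρ h v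
      rw [indToFun_mk, LinearMap.sum_apply,
        Finset.sum_eq_single (Quotient.mk (QuotientGroup.rightRel K) h)]
      · rw [LinearMap.comp_apply, LinearMap.proj_apply, Pi.single_eq_same,
          ← IndV.mk_mul ρ (cosetPart K h), cosetPart_mul_out, self_inv_apply]
      · intro q _ hq
        simp [Pi.single_eq_of_ne hq]
      · simp)

lemma finrank_indV_mul_card [FiniteDimensional ℂ V] :
    Module.finrank ℂ (IndV K.subtype ρ) * Nat.card K = Nat.card G * Module.finrank ℂ V := by
  rw [(indEquivFun K ρ).finrank_eq, Module.finrank_pi_fintype, Finset.sum_const,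
    Finset.card_univ, smul_eq_mul, ← Nat.card_eq_fintype_card,
    Nat.card_congr (QuotientGroup.quotientRightRelEquivQuotientLeftRel K),
    Subgroup.card_eq_card_quotient_mul_card_subgroup K]
  ring

/-- Compare dimensions in Ind_K^G(V_l ⊗ V_l^*) ≅ Ind_A^G(1): the left side has dimension [G : K]
(dim V_l)², the right side [G : A]. -/
lemma DynamicalDatum.finrank_sq_mul_card {A : Subgroup G} (D : DynamicalDatum A)
    (l : CharGroup A) :
    Module.finrank ℂ (D.V l) ^ 2 * Nat.card A = Nat.card D.K := by
  obtain ⟨e⟩ := D.ind_equiv l l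
  have h1 := finrank_indV_mul_card D.K (D.lin l l)
  have h2 := finrank_indV_mul_card A (charRep (l / l))
  rw [← e.toLinearEquiv.finrank_eq, Module.finrank_self, mul_one] at h2
  rw [Module.finrank_tensorProduct, Subspace.dual_finrank_eq] at h1
  have h3 : 0 < Module.finrank ℂ (IndV D.K.subtype (D.lin l l)) := by
    by_contra h0
    rw [Nat.eq_zero_of_not_pos h0, zero_mul] at h2
    exact Nat.card_pos.ne h2
  apply Nat.eq_of_mul_eq_mul_left h3
  rw [h1, ← h2]
  ring

end IndDimension

/-! ### Systems of idempotents and orbits -/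

section Orbits

/-- The trace of an idempotent is its rank and the trace is additive, so the ranks of the θ(x) add
up to the rank of their sum, which is at most dim V. No orthogonality of the θ(x) is needed. -/
lemma card_support_le_finrank {X V : Type*} [Fintype X] [AddCommGroup V] [Module ℂ V]
    [FiniteDimensional ℂ V] (θ : X → Module.End ℂ V) (hθ : ∀ x, IsIdempotentElem (θ x))
    (hs : IsIdempotentElem (∑ x, θ x)) [DecidablePred fun x => θ x ≠ 0] :
    (Finset.univ.filter fun x => θ x ≠ 0).card ≤ Module.finrank ℂ V := by
  have htr : ∀ e : Module.End ℂ V, IsIdempotentElem e →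
      LinearMap.trace ℂ V e = Module.finrank ℂ (LinearMap.range e) := fun e he =>
    (LinearMap.IsIdempotentElem.isProj_range e he).trace
  have h1 : ∑ x, Module.finrank ℂ (LinearMap.range (θ x)) =
      Module.finrank ℂ (LinearMap.range (∑ x, θ x)) := by
    have h := htr _ hs
    rw [map_sum, Finset.sum_congr rfl fun x _ => htr _ (hθ x)] at h
    exact_mod_cast h
  calc (Finset.univ.filter fun x => θ x ≠ 0).card
      = ∑ x ∈ Finset.univ.filter fun x => θ x ≠ 0, 1 := by simp
    _ ≤ ∑ x ∈ Finset.univ.filter fun x => θ x ≠ 0, Module.finrank ℂ (LinearMap.range (θ x)) := by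
        refine Finset.sum_le_sum fun x hx => ?_
        rw [Nat.one_le_iff_ne_zero, Ne, Submodule.finrank_eq_zero, LinearMap.range_eq_bot]
        exact (Finset.mem_filter.1 hx).2
    _ ≤ ∑ x, Module.finrank ℂ (LinearMap.range (θ x)) :=
        Finset.sum_le_sum_of_subset (Finset.filter_subset _ _)
    _ ≤ Module.finrank ℂ V := by
        rw [h1]
        exact Submodule.finrank_le _

/-- By equivariance, θ is nonzero on the whole orbit as soon as it is nonzero at one point. -/
lemma card_orbit_le_finrank {K X V : Type*} [Group K] [Fintype X] [MulAction K X]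
    [AddCommGroup V] [Module ℂ V] [FiniteDimensional ℂ V] (ρ : K → V ≃ₗ[ℂ] V)
    (θ : X → Module.End ℂ V) (hθ : ∀ x, IsIdempotentElem (θ x))
    (hs : IsIdempotentElem (∑ x, θ x)) (hK : ∀ k x v, θ (k • x) (ρ k v) = ρ k (θ x v))
    {x : X} (hx : θ x ≠ 0) : Nat.card (MulAction.orbit K x) ≤ Module.finrank ℂ V := by
  classical
  refine le_trans ?_ (card_support_le_finrank θ hθ hs)
  rw [Nat.card_eq_fintype_card, ← Set.toFinset_card]
  refine Finset.card_le_card fun y hy => ?_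
  rw [Set.mem_toFinset] at hy
  obtain ⟨k, rfl⟩ := hy
  refine Finset.mem_filter.2 ⟨Finset.mem_univ _, fun h0 => hx (LinearMap.ext fun v => ?_)⟩
  have h1 := hK k x v
  simp only at h0
  rw [h0, LinearMap.zero_apply] at h1
  rw [LinearMap.zero_apply]
  exact (LinearEquiv.map_eq_zero_iff _).1 h1.symm

/-- A subgroup of order at least `d² |A|` with an orbit of size at most `d` on `G / A` is conjugate
to `A`. -/
lemma eq_map_conj_of_card_orbit_le [Finite G] {A K : Subgroup G} {d : ℕ} (hd : 0 < d)
    (hK : d ^ 2 * Nat.card A = Nat.card K) (g : G)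
    (hg : Nat.card (MulAction.orbit K (g : G ⧸ A)) ≤ d) :
    K = A.map (MulAut.conj g).toMonoidHom := by
  classical
  have hstab : ∀ k : K, k • (g : G ⧸ A) = (g : G ⧸ A) ↔ g⁻¹ * (k : G) * g ∈ A := by
    intro k
    change ((((k : G) * g : G)) : G ⧸ A) = (g : G ⧸ A) ↔ _
    rw [eq_comm, QuotientGroup.eq, mul_assoc]
  have hle : Nat.card (MulAction.stabilizer K (g : G ⧸ A)) ≤ Nat.card A := by
    refine Nat.card_le_card_of_injective
      (fun k => (⟨g⁻¹ * ((k : K) : G) * g, (hstab k).1 k.2⟩ : A)) fun k k' h => ?_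
    have := congrArg Subtype.val h
    simpa using this
  have horb : Nat.card (MulAction.orbit K (g : G ⧸ A)) *
      Nat.card (MulAction.stabilizer K (g : G ⧸ A)) = Nat.card K := by
    let _ := Fintype.ofFinite K
    let _ := Fintype.ofFinite (MulAction.orbit K (g : G ⧸ A))
    let _ := Fintype.ofFinite (MulAction.stabilizer K (g : G ⧸ A))
    simp only [Nat.card_eq_fintype_card]
    exact MulAction.card_orbit_mul_card_stabilizer_eq_card_group K (g : G ⧸ A)
  have hA : 0 < Nat.card A := Nat.card_pos
  -- Orbit-stabilizer: |K| = d² |A| is at most d |A|, which leaves only d = 1 and an orbit with a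
  -- single point.
  have h1 : d ^ 2 * Nat.card A ≤ d * Nat.card A := by
    rw [hK, ← horb]
    exact Nat.mul_le_mul hg hle
  have hd1 : d = 1 := by
    have := Nat.le_of_mul_le_mul_right h1 hA
    nlinarith
  subst hd1
  have hsub : Subsingleton (MulAction.orbit K (g : G ⧸ A)) :=
    Finite.card_le_one_iff_subsingleton.1 hg
  have hKle : K ≤ A.map (MulAut.conj g).toMonoidHom := by
    intro k hk
    have h2 : (⟨k, hk⟩ : K) • (g : G ⧸ A) = (g : G ⧸ A) :=
      congrArg Subtype.val (hsub.elim ⟨_, MulAction.mem_orbit _ (⟨k, hk⟩ : K)⟩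
        ⟨_, MulAction.mem_orbit_self _⟩)
    refine ⟨g⁻¹ * k * g, (hstab ⟨k, hk⟩).1 h2, ?_⟩
    simp [mul_assoc]
  refine Subgroup.eq_of_le_of_card_ge hKle ?_
  rw [← hK, one_pow, one_mul]
  exact (Subgroup.card_map_of_injective (MulAut.conj g).injective).le

end Orbits

/-! ### Functions on a finite `G`-set -/

section Functions

variable (X : Type u) [MulAction G X]

/-- The permutation representation on functions. -/
def funRep : Representation ℂ G (X → ℂ) where
  toFun g := LinearMap.funLeft ℂ ℂ fun x => g⁻¹ • x
  map_one' := by ext; simp [LinearMap.funLeft]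
  map_mul' g h := LinearMap.ext fun φ => funext fun x => by
    simp [LinearMap.funLeft, mul_smul]

variable {X}

lemma funRep_apply (g : G) (φ : X → ℂ) (x : X) : funRep X g φ x = φ (g⁻¹ • x) := rfl

/-- Multiplication of functions is `G`-equivariant. -/
def funMul : ((funRep (G := G) X).tprod (funRep X)).IntertwiningMap (funRep X) where
  toLinearMap := LinearMap.mul' ℂ (X → ℂ)
  isIntertwining' _ := TensorProduct.ext' fun _ _ => rfl

/-- Summation of functions, with values in the constant functions, is `G`-equivariant. -/
def funSum [Fintype X] : (funRep (G := G) X).IntertwiningMap (funRep X) where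
  toLinearMap := LinearMap.pi fun _ => ∑ x : X, LinearMap.proj x
  isIntertwining' g := LinearMap.ext fun φ => funext fun x => by
    simp only [LinearMap.comp_apply, LinearMap.pi_apply, LinearMap.sum_apply, LinearMap.proj_apply,
      funRep_apply]
    exact Fintype.sum_equiv (MulAction.toPerm g⁻¹) _ _ fun _ => rfl

lemma funSum_apply [Fintype X] (φ : X → ℂ) (x : X) :
    funSum (G := G) φ x = ∑ y, φ y := by
  change (∑ y : X, LinearMap.proj (R := ℂ) (φ := fun _ => ℂ) y) φ = _
  rw [LinearMap.sum_apply]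
  rfl

variable {V : Type*} [AddCommGroup V] [Module ℂ V]

/-- The component at `x` of an element of `V ⊗ (X → ℂ)`. -/
def component (V : Type*) [AddCommGroup V] [Module ℂ V] (x : X) : V ⊗[ℂ] (X → ℂ) →ₗ[ℂ] V :=
  (TensorProduct.rid ℂ V).toLinearMap ∘ₗ (LinearMap.proj x : (X → ℂ) →ₗ[ℂ] ℂ).lTensor V

lemma component_tmul (x : X) (v : V) (φ : X → ℂ) : component V x (v ⊗ₜ φ) = φ x • v := rfl

lemma sum_component_tmul [Fintype X] [DecidableEq X] (t : V ⊗[ℂ] (X → ℂ)) :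
    ∑ x, component V x t ⊗ₜ[ℂ] (Pi.single x (1 : ℂ) : X → ℂ) = t := by
  induction t using TensorProduct.induction_on with
  | zero => simp
  | add s t hs ht => simp only [map_add, TensorProduct.add_tmul, Finset.sum_add_distrib, hs, ht]
  | tmul v φ =>
    simp only [component_tmul, TensorProduct.smul_tmul, ← TensorProduct.tmul_sum]
    congr 1
    ext x
    simp [Finset.sum_apply, Pi.single_apply]

/-- Evaluation at a point is multiplicative, so multiplying the two function legs of an iterated map
composes its components. -/
lemma component_mul (x : X) (T : V →ₗ[ℂ] V ⊗[ℂ] (X → ℂ)) (t : V ⊗[ℂ] (X → ℂ)) :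
    component V x ((LinearMap.mul' ℂ (X → ℂ)).lTensor V
      (TensorProduct.assoc ℂ V (X → ℂ) (X → ℂ) (T.rTensor (X → ℂ) t))) =
      component V x (T (component V x t)) := by
  induction t using TensorProduct.induction_on with
  | zero => simp
  | add s t hs ht => simp only [map_add, hs, ht]
  | tmul v φ =>
    rw [LinearMap.rTensor_tmul, component_tmul, map_smul, map_smul]
    induction T v using TensorProduct.induction_on with
    | zero => simp
    | add s t hs ht => simp only [map_add, TensorProduct.add_tmul, smul_add, hs, ht]
    | tmul w ψ =>
      rw [TensorProduct.assoc_tmul, LinearMap.lTensor_tmul, component_tmul, component_tmul,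
        smul_smul]
      simp [mul_comm]

lemma component_map (g : G) (x : X) (e : V →ₗ[ℂ] V) (t : V ⊗[ℂ] (X → ℂ)) :
    component V (g • x) (TensorProduct.map e (funRep X g) t) = e (component V x t) := by
  induction t using TensorProduct.induction_on with
  | zero => simp
  | add s t hs ht => simp only [map_add, hs, ht]
  | tmul v φ =>
    rw [TensorProduct.map_tmul, component_tmul, component_tmul, funRep_apply, inv_smul_smul,
      map_smul]

lemma component_funSum [Fintype X] (x : X) (t : V ⊗[ℂ] (X → ℂ)) :
    component V x ((funSum (G := G)).toLinearMap.lTensor V t) = ∑ y, component V y t := by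
  induction t using TensorProduct.induction_on with
  | zero => simp
  | add s t hs ht => simp only [map_add, Finset.sum_add_distrib, hs, ht]
  | tmul v φ =>
    rw [LinearMap.lTensor_tmul, component_tmul]
    simp only [component_tmul, ← Finset.sum_smul]
    congr 1
    exact funSum_apply φ x

end Functions

/-! ### Dynamical data of twists obtained from `1 ⊗ 1` -/

section Conjugacy

lemma weightSpace_div_self {A : Subgroup G} {U : Type u} [AddCommGroup U] [Module ℂ U]
    (τ : Representation ℂ G U) {u : U} (hu : ∀ a : A, τ (a : G) u = u) (l : CharGroup A) :
    u ∈ weightSpace A τ (l / l) := by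
  intro a
  rw [hu, div_self' l]
  simp

variable [Finite G] {A : Subgroup G} [IsMulCommutative A] {x : CharGroup A → (GrpAlg G)ˣ}
  {f : CharGroup A → CharGroup A}

lemma Realizes.mem_weightSpace_of_fixed (hx : Realizes A x f) {U : Type u} [AddCommGroup U]
    [Module ℂ U] (τ : Representation ℂ G U) {u : U} (hu : ∀ a : A, τ (a : G) u = u)
    (l : CharGroup A) : τ.asAlgebraHom (x l : GrpAlg G) u ∈ weightSpace A τ (l / l) :=
  hx.mem_weightSpace τ (weightSpace_div_self τ hu (f l))

lemma Realizes.conj_of_corresponds (hx : Realizes A x f)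
    {J : CharGroup A → GrpAlg G ⊗[ℂ] GrpAlg G}
    (hJ : ∀ l, J l = transform (bot_le : ⊥ ≤ A) (oneTwist G) x l)
    {D : DynamicalDatum A} (hD : Corresponds J D) :
    ∃ g : G, D.K = A.map (MulAut.conj g).toMonoidHom := by
  classical
  obtain ⟨E, hE⟩ := hD
  -- Only one index is needed; the trivial character is an arbitrary choice.
  let l : CharGroup A := 1
  let _ : Fintype (G ⧸ A) := Fintype.ofFinite _
  let τ : Representation ℂ G (G ⧸ A → ℂ) := funRep (G ⧸ A)
  let Θ : ∀ u : G ⧸ A → ℂ, (∀ a : A, τ (a : G) u = u) → D.homK τ l l := fun u hu =>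
    E.Ψ τ l l ⟨_, hx.mem_weightSpace_of_fixed τ hu l⟩
  have hmul : ∀ u hu, u * u = u → ∀ y, IsIdempotentElem
      (component (D.V l) y ∘ₗ (Θ u hu : D.V l →ₗ[ℂ] D.V l ⊗[ℂ] (G ⧸ A → ℂ)) :
        Module.End ℂ (D.V l)) := by
    intro u hu huu y
    obtain ⟨z, hz, hzE⟩ := hE _ _ τ τ l l l ⟨_, hx.mem_weightSpace_of_fixed τ hu l⟩
      ⟨_, hx.mem_weightSpace_of_fixed τ hu l⟩
    -- With both weights equal to l / l, `act₂_transform` says that J(l) sends x(l) u ⊗ x(l) u to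
    -- x(l) (u ⊗ u).
    have hz' : (z : (G ⧸ A → ℂ) ⊗[ℂ] (G ⧸ A → ℂ)) =
        (τ.tprod τ).asAlgebraHom (x l : GrpAlg G) (u ⊗ₜ u) := by
      have h := act₂_transform τ τ x l l (τ.asAlgebraHom (x l : GrpAlg G) u)
        (hx.mem_weightSpace_of_fixed τ hu l)
      rw [← hJ, ← hz, ← Module.End.mul_apply, ← map_mul, Units.inv_mul, map_one,
        Module.End.one_apply] at h
      rw [← h, ← Module.End.mul_apply, ← map_mul, Units.mul_inv, map_one, Module.End.one_apply]
    -- Naturality under multiplication of functions maps x(l) (u ⊗ u) to x(l) (u * u) = x(l) u; with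
    -- the exchange relation this makes the component at y idempotent.
    have hnat := E.natural (τ.tprod τ) τ funMul l l z
      ⟨_, hx.mem_weightSpace_of_fixed τ hu l⟩ (by
        have h := asAlgebraHom_comm (τ := τ.tprod τ) (σ := τ)
          (funMul (G := G) (X := G ⧸ A)).toLinearMap
          (fun g u => LinearMap.congr_fun ((funMul (G := G) (X := G ⧸ A)).isIntertwining' g) u)
          (x l : GrpAlg G) (u ⊗ₜ u)
        rw [← hz'] at h
        refine Eq.trans ?_ h.symm
        change τ.asAlgebraHom _ u = τ.asAlgebraHom _ (u * u)
        rw [huu])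
    rw [hzE] at hnat
    refine LinearMap.ext fun v => ?_
    have h := congrArg (component (D.V l) y) (LinearMap.congr_fun hnat v)
    exact ((component_mul y _ _).symm.trans h.symm)
  let δ : G ⧸ A → ℂ := Pi.single ((1 : G) : G ⧸ A) 1
  have hδ : ∀ a : A, τ (a : G) δ = δ := by
    intro a
    funext y
    change δ ((a : G)⁻¹ • y) = δ y
    have : (a : G)⁻¹ • y = ((1 : G) : G ⧸ A) ↔ y = ((1 : G) : G ⧸ A) := by
      rw [inv_smul_eq_iff]
      have h1 : (a : G) • ((1 : G) : G ⧸ A) = ((1 : G) : G ⧸ A) := by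
        change (((a : G) * 1 : G) : G ⧸ A) = _
        rw [eq_comm, QuotientGroup.eq]
        simp
      rw [h1]
    simp only [δ, Pi.single_apply, this]
  have h1 : ∀ a : A, τ (a : G) (1 : G ⧸ A → ℂ) = 1 := fun a => rfl
  let T : D.V l →ₗ[ℂ] D.V l ⊗[ℂ] (G ⧸ A → ℂ) := Θ δ hδ
  let θ : G ⧸ A → Module.End ℂ (D.V l) := fun y => component (D.V l) y ∘ₗ T
  have hθ : ∀ y, IsIdempotentElem (θ y) := hmul δ hδ (by
    funext y
    simp only [δ, Pi.mul_apply, Pi.single_apply]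
    split_ifs <;> simp)
  -- Summation of functions takes δ to the constant function 1, itself idempotent; by naturality the
  -- sum of the θ(y) is a component of Θ(1).
  have hsum : IsIdempotentElem (∑ y, θ y) := by
    have h := hmul 1 h1 (one_mul 1) ((1 : G) : G ⧸ A)
    have hnat := E.natural τ τ funSum l l ⟨_, hx.mem_weightSpace_of_fixed τ hδ l⟩
      ⟨_, hx.mem_weightSpace_of_fixed τ h1 l⟩ (by
        have h := asAlgebraHom_comm (τ := τ) (σ := τ) (funSum (G := G) (X := G ⧸ A)).toLinearMap
          (fun g u => LinearMap.congr_fun ((funSum (G := G) (X := G ⧸ A)).isIntertwining' g) u)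
          (x l : GrpAlg G) δ
        refine Eq.trans ?_ h.symm
        change τ.asAlgebraHom _ (1 : G ⧸ A → ℂ) = τ.asAlgebraHom _ (funSum (G := G) δ)
        congr 1
        funext y
        rw [funSum_apply]
        simp [δ, Pi.single_apply])
    have h2 : (component (D.V l) ((1 : G) : G ⧸ A) ∘ₗ
        (Θ 1 h1 : D.V l →ₗ[ℂ] D.V l ⊗[ℂ] (G ⧸ A → ℂ))) = ∑ y, θ y := by
      refine LinearMap.ext fun v => ?_
      rw [LinearMap.comp_apply, LinearMap.sum_apply]
      exact (congrArg (component (D.V l) ((1 : G) : G ⧸ A)) (LinearMap.congr_fun hnat v)).trans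
        (component_funSum _ _)
    rwa [h2] at h
  have hK : ∀ (k : D.K) (y : G ⧸ A) (v : D.V l), θ (k • y) (D.ρ l k v) = D.ρ l k (θ y v) := by
    intro k y v
    have h := (Θ δ hδ).2 k v
    exact (congrArg (component (D.V l) (k • y)) h).trans (component_map (k : G) y _ _)
  -- Otherwise Ψ(x(l) δ) = 0, which is impossible since Ψ is injective and x(l) is invertible.
  obtain ⟨y, hy⟩ : ∃ y, θ y ≠ 0 := by
    by_contra! h0
    have hT : T = 0 := LinearMap.ext fun v => by
      rw [LinearMap.zero_apply, ← sum_component_tmul (T v)]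
      refine Finset.sum_eq_zero fun y _ => ?_
      have : component (D.V l) y (T v) = 0 := LinearMap.congr_fun (h0 y) v
      rw [this, TensorProduct.zero_tmul]
    have h2 : Θ δ hδ = 0 := Subtype.ext hT
    have h3 := (LinearEquiv.map_eq_zero_iff _).1 h2
    have h4 : τ.asAlgebraHom (x l : GrpAlg G) δ = 0 := congrArg Subtype.val h3
    have h5 : δ = 0 := by
      rw [← Module.End.one_apply (R := ℂ) δ, ← map_one τ.asAlgebraHom, ← Units.inv_mul (x l),
        map_mul, Module.End.mul_apply, h4, map_zero]
    have h6 := congrFun h5 ((1 : G) : G ⧸ A)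
    simp [δ] at h6
  obtain ⟨g, rfl⟩ := QuotientGroup.mk_surjective y
  have := D.nontrivial l
  exact ⟨g, eq_map_conj_of_card_orbit_le Module.finrank_pos (D.finrank_sq_mul_card l) g
    (card_orbit_le_finrank (D.ρ l) θ hθ hsum hK hy)⟩

end Conjugacy

/-! ### Dynamical data with one-dimensional representations -/

section Coordinates

variable {A : Subgroup G} (D : DynamicalDatum A) (hd : ∀ l, Module.finrank ℂ (D.V l) = 1)

/-- A coordinate on the one-dimensional space `V_l`. -/
def DynamicalDatum.coord (l : CharGroup A) : D.V l ≃ₗ[ℂ] ℂ :=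
  LinearEquiv.ofFinrankEq _ _ ((hd l).trans (Module.finrank_self ℂ).symm)

/-- The basis vector of `V_l` of coordinate `1`. -/
def DynamicalDatum.gen (l : CharGroup A) : D.V l := (D.coord hd l).symm 1

lemma DynamicalDatum.coord_smul_gen (l : CharGroup A) (v : D.V l) :
    D.coord hd l v • D.gen hd l = v := by
  apply (D.coord hd l).injective
  simp [DynamicalDatum.gen]

lemma DynamicalDatum.coord_gen (l : CharGroup A) : D.coord hd l (D.gen hd l) = 1 := by
  simp [DynamicalDatum.gen]

lemma DynamicalDatum.gen_ne_zero (l : CharGroup A) : D.gen hd l ≠ 0 := by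
  intro h
  have := D.coord_gen hd l
  rw [h, map_zero] at this
  exact zero_ne_one this

/-- The scalar by which an element of `K` acts on `V_l`. -/
def DynamicalDatum.scalar (l : CharGroup A) (k : D.K) : ℂ := D.coord hd l (D.ρ l k (D.gen hd l))

lemma DynamicalDatum.ρ_apply (l : CharGroup A) (k : D.K) (v : D.V l) :
    D.ρ l k v = D.scalar hd l k • v := by
  conv_lhs => rw [← D.coord_smul_gen hd l v]
  rw [map_smul, ← D.coord_smul_gen hd l (D.ρ l k (D.gen hd l)), smul_comm, D.coord_smul_gen hd]
  rfl

lemma DynamicalDatum.scalar_ne_zero (l : CharGroup A) (k : D.K) : D.scalar hd l k ≠ 0 := by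
  intro h
  have h1 := D.ρ_apply hd l k (D.gen hd l)
  rw [h, zero_smul] at h1
  exact D.gen_ne_zero hd l ((LinearEquiv.map_eq_zero_iff _).1 h1)

/-- The identification `V_l ⊗ U ≅ U`. -/
def DynamicalDatum.coordTensor (l : CharGroup A) (U : Type*) [AddCommGroup U] [Module ℂ U] :
    D.V l ⊗[ℂ] U ≃ₗ[ℂ] U :=
  ((D.coord hd l).rTensor U).trans (TensorProduct.lid ℂ U)

lemma DynamicalDatum.coordTensor_tmul (l : CharGroup A) {U : Type*} [AddCommGroup U] [Module ℂ U]
    (v : D.V l) (u : U) : D.coordTensor hd l U (v ⊗ₜ u) = D.coord hd l v • u := by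
  simp [DynamicalDatum.coordTensor]

lemma DynamicalDatum.gen_tmul_coordTensor (l : CharGroup A) {U : Type*} [AddCommGroup U]
    [Module ℂ U] (t : D.V l ⊗[ℂ] U) : D.gen hd l ⊗ₜ D.coordTensor hd l U t = t := by
  apply (D.coordTensor hd l U).injective
  rw [D.coordTensor_tmul, D.coord_gen, one_smul]

end Coordinates

/-! ### Exchange isomorphisms on lines as actions of elements of ℂ[G] -/

section Exchange

variable {A : Subgroup G} {D : DynamicalDatum A} (E : ExchangeSystem D)
  (hd : ∀ l, Module.finrank ℂ (D.V l) = 1)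

/-- The exchange isomorphism in coordinates. -/
def ExchangeSystem.ψ {U : Type u} [AddCommGroup U] [Module ℂ U] [FiniteDimensional ℂ U]
    (τ : Representation ℂ G U) (l m : CharGroup A) (u : weightSpace A τ (l / m)) : U :=
  D.coordTensor hd m U ((E.Ψ τ l m u : D.V l →ₗ[ℂ] D.V m ⊗[ℂ] U) (D.gen hd l))

variable {U W : Type u} [AddCommGroup U] [Module ℂ U] [FiniteDimensional ℂ U]
  [AddCommGroup W] [Module ℂ W] [FiniteDimensional ℂ W] (τ : Representation ℂ G U)
  (σ : Representation ℂ G W)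

lemma ExchangeSystem.Ψ_gen (l m : CharGroup A) (u : weightSpace A τ (l / m)) :
    (E.Ψ τ l m u : D.V l →ₗ[ℂ] D.V m ⊗[ℂ] U) (D.gen hd l) = D.gen hd m ⊗ₜ E.ψ hd τ l m u :=
  (D.gen_tmul_coordTensor hd m _).symm

lemma ExchangeSystem.eq_zero_of_ψ_eq_zero {l m : CharGroup A} {u : weightSpace A τ (l / m)}
    (hu : E.ψ hd τ l m u = 0) : u = 0 := by
  apply (LinearEquiv.map_eq_zero_iff (E.Ψ τ l m)).1
  refine Subtype.ext (LinearMap.ext fun v => ?_)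
  rw [← D.coord_smul_gen hd l v, map_smul, E.Ψ_gen hd, hu, TensorProduct.tmul_zero, smul_zero]
  rfl

lemma ExchangeSystem.ψ_equivariant (l m : CharGroup A) (u : weightSpace A τ (l / m)) (k : D.K) :
    D.scalar hd m k • τ (k : G) (E.ψ hd τ l m u) = D.scalar hd l k • E.ψ hd τ l m u := by
  have h := (E.Ψ τ l m u).2 k (D.gen hd l)
  rw [D.ρ_apply hd, map_smul, E.Ψ_gen hd, TensorProduct.map_tmul, LinearEquiv.coe_coe,
    D.ρ_apply hd] at h
  have h1 := congrArg (D.coordTensor hd m U) h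
  rw [map_smul, D.coordTensor_tmul, D.coordTensor_tmul, map_smul, D.coord_gen, one_smul,
    smul_eq_mul, mul_one] at h1
  exact h1.symm

lemma ExchangeSystem.ψ_natural {τ : Representation ℂ G U} {σ : Representation ℂ G W}
    (φ : τ.IntertwiningMap σ) {l m : CharGroup A} {u : weightSpace A τ (l / m)}
    {w : weightSpace A σ (l / m)} (h : (w : W) = φ (u : U)) :
    E.ψ hd σ l m w = φ (E.ψ hd τ l m u) := by
  have h1 := LinearMap.congr_fun (E.natural τ σ φ l m u w h) (D.gen hd l)
  rw [LinearMap.comp_apply, E.Ψ_gen hd, E.Ψ_gen hd, LinearMap.lTensor_tmul] at h1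
  have h2 := congrArg (D.coordTensor hd m W) h1
  rw [D.coordTensor_tmul, D.coordTensor_tmul, D.coord_gen, one_smul, one_smul] at h2
  exact h2

/-- The scalars by which `K` acts determine the weight. -/
lemma ExchangeSystem.eq_of_scalar_eq (E : ExchangeSystem D) {m n : CharGroup A}
    (h : ∀ k, D.scalar hd m k = D.scalar hd n k) : m = n := by
  -- Test on the trivial module: equal scalars make V_m → V_n ⊗ 1 a nonzero K-map, so the trivial
  -- module has a nonzero vector of weight m / n, and hence m = n.
  let τ : Representation ℂ G (ULift.{u} ℂ) := Representation.trivial ℂ G (ULift.{u} ℂ)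
  let t : ULift.{u} ℂ := ⟨1⟩
  let φ : D.V m →ₗ[ℂ] D.V n ⊗[ℂ] ULift.{u} ℂ :=
    LinearMap.toSpanSingleton ℂ _ (D.gen hd n ⊗ₜ t) ∘ₗ (D.coord hd m).toLinearMap
  have hφv : ∀ v, φ v = D.coord hd m v • (D.gen hd n ⊗ₜ t) := fun v => rfl
  have hφ : φ ∈ D.homK τ m n := by
    intro k v
    rw [hφv, hφv, map_smul, TensorProduct.map_tmul, LinearEquiv.coe_coe, D.ρ_apply hd,
      D.ρ_apply hd, map_smul, h, ← TensorProduct.smul_tmul', smul_eq_mul, mul_comm, mul_smul]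
    rfl
  obtain ⟨u, hu⟩ := (E.Ψ τ m n).surjective ⟨φ, hφ⟩
  have hu0 : (u : ULift.{u} ℂ) ≠ 0 := by
    intro h0
    have hu0 : u = 0 := Subtype.ext h0
    rw [hu0, map_zero] at hu
    have h1 : φ (D.gen hd m) = 0 := by
      rw [← show (0 : D.V m →ₗ[ℂ] D.V n ⊗[ℂ] ULift.{u} ℂ) = φ from congrArg Subtype.val hu]
      rfl
    rw [hφv, D.coord_gen, one_smul] at h1
    have h2 := congrArg (D.coordTensor hd n _) h1
    rw [D.coordTensor_tmul, D.coord_gen, one_smul, map_zero] at h2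
    exact one_ne_zero (congrArg ULift.down h2)
  ext a
  have h1 : (u : ULift.{u} ℂ) = (((m / n) a : ℂˣ) : ℂ) • (u : ULift.{u} ℂ) := u.2 a
  have h2 : (((m / n) a : ℂˣ) : ℂ) = 1 := by
    apply smul_left_injective ℂ hu0
    simp only [one_smul]
    exact h1.symm
  rw [MonoidHom.div_apply, Units.val_eq_one, div_eq_one] at h2
  rw [h2]

variable [Finite G] [IsMulCommutative A]

lemma idem_mem_weightSpace (m : CharGroup A) :
    idem A m ∈ weightSpace A (Representation.leftRegular ℂ G) m := by
  rw [mem_weightSpace_iff, leftRegular_asAlgebraHom_apply, idem_mul_self]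

/-- The element of `ℂ[G]` by which the exchange isomorphism acts. -/
def ExchangeSystem.element (l m : CharGroup A) : GrpAlg G :=
  E.ψ hd (Representation.leftRegular ℂ G) l m ⟨_, idem_mem_weightSpace (l / m)⟩

/-- A Yoneda argument: a vector u of weight l / m is the image of P_{l / m} under the module map h ↦
h u from the regular representation, and ψ is natural. -/
lemma ExchangeSystem.ψ_eq (l m : CharGroup A) (u : weightSpace A τ (l / m)) :
    E.ψ hd τ l m u = τ.asAlgebraHom (E.element hd l m) (u : U) := by
  let φ : (Representation.leftRegular ℂ G).IntertwiningMap τ :=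
    { toLinearMap := LinearMap.applyₗ (u : U) ∘ₗ τ.asAlgebraHom.toLinearMap
      isIntertwining' := fun g => LinearMap.ext fun h => by
        change τ.asAlgebraHom (Representation.leftRegular ℂ G g h) (u : U) =
          τ g (τ.asAlgebraHom h (u : U))
        rw [leftRegular_apply, map_mul, Module.End.mul_apply, Representation.asAlgebraHom_of] }
  exact E.ψ_natural hd φ ((mem_weightSpace_iff τ _ _).1 u.2).symm

lemma ExchangeSystem.element_mul_idem (l m : CharGroup A) :
    E.element hd l m * idem A (l / m) = E.element hd l m := by
  have := E.ψ_eq hd (Representation.leftRegular ℂ G) l m ⟨_, idem_mem_weightSpace (l / m)⟩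
  rw [leftRegular_asAlgebraHom_apply] at this
  exact this.symm

lemma ExchangeSystem.element_ne_zero (l m : CharGroup A) : E.element hd l m ≠ 0 := by
  intro h
  have := E.eq_zero_of_ψ_eq_zero hd _ h
  exact idem_ne_zero (l / m) (congrArg Subtype.val this)

lemma ExchangeSystem.gpEl_mul_element (l m : CharGroup A) (k : D.K) :
    gpEl (k : G) * E.element hd l m =
      ((D.scalar hd m k)⁻¹ * D.scalar hd l k) • E.element hd l m := by
  have h := E.ψ_equivariant hd (Representation.leftRegular ℂ G) l m
    ⟨_, idem_mem_weightSpace (l / m)⟩ k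
  rw [leftRegular_apply] at h
  rw [mul_smul]
  exact (inv_smul_smul₀ (D.scalar_ne_zero hd m k) _).symm.trans
    (congrArg ((D.scalar hd m k)⁻¹ • ·) h)

/-- Multiplication by the (l, m) element is ψ on the weight component P_{l / m} h, where it is
injective; these components add up to h. -/
lemma ExchangeSystem.mul_eq_zero {l : CharGroup A} {h : GrpAlg G}
    (hh : ∀ m, E.element hd l m * h = 0) : h = 0 := by
  rw [← one_mul h, ← sum_idem A, Finset.sum_mul]
  refine Finset.sum_eq_zero fun m _ => ?_
  obtain ⟨k, rfl⟩ : ∃ k, m = l / k := ⟨l / m, (div_div_cancel l m).symm⟩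
  have hmem : idem A (l / k) * h ∈ weightSpace A (Representation.leftRegular ℂ G) (l / k) := by
    rw [mem_weightSpace_iff, leftRegular_asAlgebraHom_apply, ← mul_assoc, idem_mul_self]
  have h0 := E.ψ_eq hd (Representation.leftRegular ℂ G) l k ⟨_, hmem⟩
  rw [leftRegular_asAlgebraHom_apply, ← mul_assoc, E.element_mul_idem, hh] at h0
  exact congrArg Subtype.val (E.eq_zero_of_ψ_eq_zero hd _ h0)

/-- The exchange relation for two copies of the regular representation, evaluated on P_{m / n} ⊗
P_{l / m} and read in coordinates. -/
lemma ExchangeSystem.Delta_element_mul {J : CharGroup A → GrpAlg G ⊗[ℂ] GrpAlg G}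
    (hE : ∀ (U W : Type u) [AddCommGroup U] [Module ℂ U] [FiniteDimensional ℂ U]
      [AddCommGroup W] [Module ℂ W] [FiniteDimensional ℂ W]
      (τ : Representation ℂ G U) (σ : Representation ℂ G W) (l m n : CharGroup A)
      (v : weightSpace A τ (m / n)) (w : weightSpace A σ (l / m)),
      ∃ z : weightSpace A (τ.tprod σ) (l / n),
        (z : U ⊗[ℂ] W) = act₂ τ σ (J l) ((v : U) ⊗ₜ[ℂ] (w : W)) ∧
        (E.Ψ (τ.tprod σ) l n z : D.V l →ₗ[ℂ] D.V n ⊗[ℂ] (U ⊗[ℂ] W)) =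
          (TensorProduct.assoc ℂ (D.V n) U W).toLinearMap ∘ₗ
            ((E.Ψ τ m n v : D.V m →ₗ[ℂ] D.V n ⊗[ℂ] U).rTensor W) ∘ₗ
              (E.Ψ σ l m w : D.V l →ₗ[ℂ] D.V m ⊗[ℂ] W)) (l m n : CharGroup A) :
    Delta G (E.element hd l n) * (J l * (idem A (m / n) ⊗ₜ[ℂ] idem A (l / m))) =
      E.element hd m n ⊗ₜ E.element hd l m := by
  obtain ⟨z, hz, hΨ⟩ := hE _ _ (Representation.leftRegular ℂ G) (Representation.leftRegular ℂ G)
    l m n ⟨_, idem_mem_weightSpace (m / n)⟩ ⟨_, idem_mem_weightSpace (l / m)⟩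
  have h1 := E.ψ_eq hd _ l n z
  rw [hz, ← act₂_Delta, act₂_leftRegular, act₂_leftRegular] at h1
  rw [← h1]
  have h2 := LinearMap.congr_fun hΨ (D.gen hd l)
  rw [LinearMap.comp_apply, LinearMap.comp_apply, E.Ψ_gen hd, E.Ψ_gen hd, LinearMap.rTensor_tmul,
    E.Ψ_gen hd, LinearEquiv.coe_coe, TensorProduct.assoc_tmul] at h2
  have h3 := congrArg (D.coordTensor hd n _) h2
  rw [D.coordTensor_tmul, D.coordTensor_tmul, D.coord_gen, one_smul, one_smul] at h3
  exact h3

end Exchange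

/-! ### Twists corresponding to dynamical data with `K` conjugate to `A` -/

section Obtained

lemma exists_char_of_smul {A : Subgroup G} {y : GrpAlg G} (hy : y ≠ 0) {F : A → ℂ}
    (hF : ∀ a : A, gpEl (a : G) * y = F a • y) :
    ∃ χ : CharGroup A, ∀ a, ((χ a : ℂˣ) : ℂ) = F a := by
  have h1 : F 1 = 1 := by
    apply smul_left_injective ℂ hy
    simp only [one_smul]
    rw [← hF, Subgroup.coe_one, gpEl_one, one_mul]
  have hmul : ∀ a b, F (a * b) = F a * F b := by
    intro a b
    apply smul_left_injective ℂ hy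
    simp only
    rw [← hF, Subgroup.coe_mul, gpEl_mul, mul_assoc, hF, mul_smul_comm, hF, smul_smul, mul_comm]
  exact ⟨MonoidHom.toHomUnits { toFun := F, map_one' := h1, map_mul' := hmul }, fun a => rfl⟩

/-- `ε ⊗ ε`. -/
def epsTmul (G : Type u) [Group G] : GrpAlg G ⊗[ℂ] GrpAlg G →ₐ[ℂ] ℂ :=
  (eps G).comp ((Algebra.TensorProduct.lid ℂ (GrpAlg G)).toAlgHom.comp
    (Algebra.TensorProduct.map (eps G) (AlgHom.id ℂ (GrpAlg G))))

lemma epsTmul_tmul (a b : GrpAlg G) : epsTmul G (a ⊗ₜ b) = eps G a * eps G b := by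
  change eps G (eps G a • b) = _
  rw [map_smul, smul_eq_mul]

lemma epsTmul_Delta (h : GrpAlg G) : epsTmul G (Delta G h) = eps G h := by
  induction h using MonoidAlgebra.induction_on with
  | of g => rw [Delta_gpEl, epsTmul_tmul, eps_gpEl, one_mul]
  | add x y hx hy => simp only [map_add, hx, hy]
  | smul r x hx => simp only [map_smul, hx]

variable [Finite G] {A : Subgroup G} [IsMulCommutative A]

/-- By finite dimension, left multiplication by X is also onto, giving a right inverse; injectivity
makes it two-sided. -/
lemma isUnit_of_mul_left_injective {X : GrpAlg G} (hX : ∀ h, X * h = 0 → h = 0) : IsUnit X := by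
  have hinj : Function.Injective (LinearMap.mulLeft ℂ X) :=
    (injective_iff_map_eq_zero _).2 hX
  obtain ⟨Y, hY⟩ := (LinearMap.injective_iff_surjective.1 hinj) 1
  have hXY : X * Y = 1 := hY
  have hYX : Y * X = 1 := by
    rw [← sub_eq_zero]
    apply hX
    rw [mul_sub, ← mul_assoc, hXY, one_mul, mul_one, sub_self]
  exact ⟨⟨X, Y, hXY, hYX⟩, rfl⟩

lemma obtainedFromOne_of_corresponds {J : CharGroup A → GrpAlg G ⊗[ℂ] GrpAlg G}
    (hJ : IsDynamicalTwist A J) {D : DynamicalDatum A} (hD : Corresponds J D) {g : G}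
    (hg : D.K = A.map (MulAut.conj g).toMonoidHom) : ObtainedFromOne A J := by
  classical
  obtain ⟨E, hE⟩ := hD
  have hd : ∀ l, Module.finrank ℂ (D.V l) = 1 := by
    intro l
    have h := D.finrank_sq_mul_card l
    rw [hg, Subgroup.card_map_of_injective (MulAut.conj g).injective] at h
    have h1 : Module.finrank ℂ (D.V l) ^ 2 = 1 :=
      Nat.eq_of_mul_eq_mul_right (Nat.card_pos (α := A)) (by rw [h, one_mul])
    exact (Nat.pow_eq_one.1 h1).resolve_right two_ne_zero
  have hmem : ∀ a : A, g * (a : G) * g⁻¹ ∈ D.K := by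
    intro a
    rw [hg]
    exact ⟨a, a.2, rfl⟩
  -- the components `g⁻¹ y` of `x(l)⁻¹` and their weights
  let y : CharGroup A → CharGroup A → GrpAlg G := fun l m => gpEl g⁻¹ * E.element hd l m
  have hy0 : ∀ l m, y l m ≠ 0 := by
    intro l m h
    apply E.element_ne_zero hd l m
    rw [← one_mul (E.element hd l m), ← gpEl_one, ← mul_inv_cancel g, gpEl_mul, mul_assoc]
    exact (congrArg (gpEl g * ·) h).trans (mul_zero _)
  have hyw : ∀ l m (a : A), gpEl (a : G) * y l m =
      ((D.scalar hd m ⟨_, hmem a⟩)⁻¹ * D.scalar hd l ⟨_, hmem a⟩) • y l m := by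
    intro l m a
    rw [← mul_smul_comm, ← E.gpEl_mul_element, ← mul_assoc, ← mul_assoc, ← gpEl_mul, ← gpEl_mul]
    simp [mul_assoc]
  choose χ hχ using fun l m => exists_char_of_smul (hy0 l m) (hyw l m)
  -- Every element of K has the form g a g⁻¹, so equal characters of A mean equal scalars of K on
  -- V_m and V_n.
  have hχinj : ∀ l, Function.Injective (χ l) := by
    intro l m n hmn
    refine E.eq_of_scalar_eq hd fun k => ?_
    obtain ⟨a, rfl⟩ : ∃ a : A, (⟨_, hmem a⟩ : D.K) = k := by
      obtain ⟨a, ha, hak⟩ := hg.le k.2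
      exact ⟨⟨a, ha⟩, Subtype.ext hak⟩
    have h := hχ l m a
    rw [hmn, hχ l n a] at h
    exact (inv_injective (mul_right_cancel₀ (D.scalar_ne_zero hd l _) h)).symm
  have hyP : ∀ l m k, idem A (χ l k) * y l m = if m = k then y l m else 0 := by
    intro l m k
    rw [idem_mul_of_weight (χ l m) (χ l k) fun a => by rw [hyw, hχ]]
    simp only [(hχinj l).eq_iff]
  have hyR : ∀ l m k, y l m * idem A (l / k) = if m = k then y l m else 0 := by
    intro l m k
    change gpEl g⁻¹ * _ * _ = if m = k then gpEl g⁻¹ * _ else 0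
    rw [mul_assoc]
    split_ifs with h
    · rw [← h, E.element_mul_idem]
    · rw [← E.element_mul_idem, mul_assoc,
        idem_mul_idem_of_ne fun h' => h (div_right_injective (G := CharGroup A) h'),
        mul_zero, mul_zero]
  let X : CharGroup A → GrpAlg G := fun l => ∑ m, y l m
  have hXl : ∀ l k, idem A (χ l k) * X l = y l k := by
    intro l k
    simp only [X, Finset.mul_sum, hyP, Finset.sum_ite_eq', Finset.mem_univ, if_true]
  have hXr : ∀ l k, X l * idem A (l / k) = y l k := by
    intro l k
    simp only [X, Finset.sum_mul, hyR, Finset.sum_ite_eq', Finset.mem_univ, if_true]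
  clear_value X
  -- If X(l) h = 0, cutting with P_{χ(l, m)} on the left isolates each summand, and every element of
  -- the exchange system kills h.
  have hXu : ∀ l, IsUnit (X l) := by
    intro l
    refine isUnit_of_mul_left_injective fun h hh => E.mul_eq_zero hd (l := l) fun m => ?_
    have h1 : y l m * h = 0 := by rw [← hXl, mul_assoc, hh, mul_zero]
    rw [← one_mul (E.element hd l m), ← gpEl_one, ← mul_inv_cancel g, gpEl_mul, mul_assoc,
      mul_assoc, ← mul_assoc (gpEl g⁻¹)]
    exact (congrArg (gpEl g * ·) h1).trans (mul_zero _)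
  have hXJ : ∀ l, Delta G (X l) * J l =
      ∑ q : CharGroup A, X (l / q) ⊗ₜ[ℂ] (X l * idem A q) := by
    intro l
    apply ext_mul_idem_tmul (A := A)
    intro r q
    obtain ⟨m, rfl⟩ : ∃ m, q = l / m := ⟨l / q, (div_div_cancel l q).symm⟩
    obtain ⟨n, rfl⟩ : ∃ n, r = m / n := ⟨m / r, (div_div_cancel m r).symm⟩
    -- Inserting Δ(P_{l / n}) and moving it past J(l), by zero weight, replaces X(l) by its summand
    -- y(l, n), to which the exchange relation applies.
    have h1 : idem A (m / n) ⊗ₜ[ℂ] idem A (l / m) =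
        Delta G (idem A (l / n)) * (idem A (m / n) ⊗ₜ[ℂ] idem A (l / m)) := by
      have h2 : m / n * (l / m) = l / n := by
        rw [mul_comm (m / n)]
        exact div_mul_div_cancel l m n
      rw [Delta_idem_mul, if_pos h2]
    have h2 : J l * Delta G (idem A (l / n)) = Delta G (idem A (l / n)) * J l :=
      ((zeroWeight₂_iff (J l)).1 (hJ.zeroWeight l) (l / n)).symm
    have h3 : Delta G (X l) * J l * (idem A (m / n) ⊗ₜ[ℂ] idem A (l / m)) =
        y m n ⊗ₜ y l m := by
      rw [h1, mul_assoc, ← mul_assoc (J l), h2, mul_assoc, ← mul_assoc (Delta G (X l)), ← map_mul,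
        hXr]
      change Delta G (gpEl g⁻¹ * E.element hd l n) * _ = _
      rw [map_mul, mul_assoc, E.Delta_element_mul hd hE, Delta_gpEl,
        Algebra.TensorProduct.tmul_mul_tmul]
    rw [h3, Finset.sum_mul, Finset.sum_eq_single (l / m)]
    · rw [Algebra.TensorProduct.tmul_mul_tmul, mul_assoc, idem_mul_self, hXr, div_div_cancel l m,
        hXr]
    · intro q _ hq
      rw [Algebra.TensorProduct.tmul_mul_tmul, mul_assoc (X l), idem_mul_idem_of_ne hq, mul_zero,
        TensorProduct.tmul_zero]
    · simp
  let x : CharGroup A → (GrpAlg G)ˣ := fun l => (hXu l).unit⁻¹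
  have hxX : ∀ l, (↑(x l)⁻¹ : GrpAlg G) = X l := fun l => by simp [x]
  have hJx : ∀ l, J l = transform (bot_le : ⊥ ≤ A) (oneTwist G) x l := by
    intro l
    have h := transform_mul_left_inv x l
    simp only [hxX] at h
    rw [← hXJ, ← hxX] at h
    have h1 := congrArg (Delta G (x l : GrpAlg G) * ·) h
    simp only [← mul_assoc, ← map_mul, Units.mul_inv, map_one, one_mul] at h1
    exact h1.symm
  -- Apply ε ⊗ ε to the relation for Δ(X(l)) J(l): since ε(P_q) = 0 unless q = 1, it reads ε(X(l)) =
  -- ε(X(l))², and ε(X(l)) is nonzero.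
  have hε : ∀ l, eps G (x l : GrpAlg G) = 1 := by
    intro l
    have hmul : eps G (X l) * eps G (x l : GrpAlg G) = 1 := by
      rw [← map_mul, ← hxX, Units.inv_mul, map_one]
    have h := congrArg (epsTmul G) (hXJ l)
    have h1 : epsTmul G (J l) = 1 := by
      refine (congrArg (eps G) (hJ.counit_left l)).trans (map_one _)
    rw [map_mul, epsTmul_Delta, h1, mul_one, map_sum, Finset.sum_eq_single 1] at h
    · rw [epsTmul_tmul, map_mul, eps_idem, if_pos rfl, mul_one, div_one l] at h
      have h0 : eps G (X l) ≠ 0 := left_ne_zero_of_mul_eq_one hmul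
      have h2 : eps G (X l) = 1 := mul_left_cancel₀ h0 (by rw [← h, mul_one])
      rwa [h2, one_mul] at hmul
    · intro q _ hq
      rw [epsTmul_tmul, map_mul, eps_idem, if_neg hq, mul_zero, mul_zero]
    · simp
  refine ⟨x, ⟨⟨?_, hε, fun l => by rw [← hJx]; exact hJ.zeroWeight l⟩, fun l => ?_⟩, hJx⟩
  · intro l b hb
    rw [Subgroup.mem_bot] at hb
    subst hb
    rw [gpEl_one, one_mul, mul_one]
  · have hx : ∀ m, (↑(x l)⁻¹ : GrpAlg G) * idem A m * (x l : GrpAlg G) =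
        idem A (χ l (l / m)) := by
      intro m
      -- Both sides are the summand y(l, l / m), cut out by its right weight and by its left weight.
      have h : X l * idem A m = idem A (χ l (l / m)) * X l := by
        rw [hXl, ← hXr, div_div_cancel l m]
      rw [hxX, h, ← hxX, Units.inv_mul_cancel_right]
    exact memNormalizer_of_perm (Finite.injective_iff_bijective.1 (injective_of_conj hx)) hx

end Obtained

end DynTwist

end

theorem proposition3p3 {G : Type*} [Group G] [Finite G] (A : Subgroup G) [IsMulCommutative A] :
    (∀ f : DynTwist.CharGroup A → DynTwist.CharGroup A,
      (∃ x : DynTwist.CharGroup A → (DynTwist.GrpAlg G)ˣ, DynTwist.Realizes A x f) ↔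
        ∀ l m : DynTwist.CharGroup A, Nonempty
          ((DynTwist.indChar A (l / m)).Equiv (DynTwist.indChar A (f l / f m)))) ∧
    (∀ J : DynTwist.CharGroup A →
        TensorProduct ℂ (DynTwist.GrpAlg G) (DynTwist.GrpAlg G),
      DynTwist.IsDynamicalTwist A J →
        (DynTwist.ObtainedFromOne A J ↔
          ∃ D : DynTwist.DynamicalDatum A, DynTwist.Corresponds J D ∧ D.K = A) ∧
        (∀ D : DynTwist.DynamicalDatum A, DynTwist.Corresponds J D →
          (DynTwist.ObtainedFromOne A J ↔
            ∃ g : G, D.K = A.map (MulAut.conj g).toMonoidHom))) := by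
  refine ⟨DynTwist.exists_realizes_iff, fun J hJ => ⟨⟨?_, ?_⟩, fun D hD => ⟨?_, ?_⟩⟩⟩
  · rintro ⟨x, hx, hJx⟩
    obtain ⟨f, hf⟩ := hx.exists_realizes
    have hf' := (DynTwist.exists_realizes_iff f).1 ⟨x, hf⟩
    exact ⟨DynTwist.oneDimDatum f hf', hf.corresponds hf' hJx, rfl⟩
  · rintro ⟨D, hD, hK⟩
    refine DynTwist.obtainedFromOne_of_corresponds hJ hD (g := 1) (hK.trans ?_)
    ext a
    simp
  · rintro ⟨x, hx, hJx⟩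
    obtain ⟨f, hf⟩ := hx.exists_realizes
    exact hf.conj_of_corresponds hJx hD
  · rintro ⟨g, hg⟩
    exact DynTwist.obtainedFromOne_of_corresponds hJ hD hg
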